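/- Manifolds are smooth, Hausdorff, second countable and without boundary. A bivector field $\pi$ on $M$ is Poisson if the bracket $\{f,g\}=\pi(df,dg)$ satisfies the Jacobi identity. A Poisson structure $\pi$ on a manifold of dimension $2m$ is *log symplectic* if $\wedge^m\pi$, as a section of the line bundle $\wedge^{2m}TM$, is transverse to the zero section. A Poisson manifold $(M,\pi)$ with $\pi\not\equiv 0$ is *log-f symplectic* if, for the unique integer $k$ with $\wedge^k\pi\not\equiv 0$ and $\wedge^{k+1}\pi\equiv 0$, there is a rank one vector subbundle $K\subset\wedge^{2k}TM$ such that $\wedge^k\pi$ is a section of $K$ which is transverse to the zero section. In that case there is a unique distribution $D\subset TM$ of rank $2k$ with $\wedge^{2k}D=K$, namely $D_x=\{v\in T_xM : v\wedge\kappa=0 \text{ for all } \kappa\in K_x\}$, and $D$ is involutive; its leaves are its maximal connected integral manifolds. **Proposition 3.6.** Let $(M,\pi)$ be a log-f symplectic manifold with corresponding distribution $D$. Assume that $M/D$, the quotient of $M$ by the foliation integrating $D$, has a smooth manifold structure such that the projection $\mathrm{pr}\colon M\to M/D$ is a submersion. Then there is a set $X\subset M/D$ of measure zero (its image in every smooth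 chart is Lebesgue null) such that for every $c\in (M/D)\setminus X$ the leaf $P=\mathrm{pr}^{-1}(c)$, an embedded submanifold of $M$ of dimension $2k$ with $T_pP=D_p$ for all $p\in P$, is log symplectic for the restriction of $\pi$: there is a log symplectic structure $\pi_P$ on $P$ whose push-forward under the inclusion $P\hookrightarrow M$ is $\pi$ at every point of $P$. -/

import Mathlib

open scoped Manifold ContDiff

universe u v

noncomputable section

/-! ## Multivector fields

Throughout, `M` is a manifold without boundary modelled on `ℝⁿ = EuclideanSpace ℝ (Fin n)`. -/

/-- A (not necessarily smooth) section of `⋀^r TM`. -/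
abbrev MultivectorField (n : ℕ) (M : Type u) [TopologicalSpace M]
    [ChartedSpace (EuclideanSpace ℝ (Fin n)) M] (r : ℕ) : Type u :=
  ∀ x : M, ⋀[ℝ]^r (TangentSpace (𝓡 n) x)

/-- The differential `df_x` of a real function, as a covector at `x`. -/
def covector {n : ℕ} {M : Type u} [TopologicalSpace M]
    [ChartedSpace (EuclideanSpace ℝ (Fin n)) M] (f : M → ℝ) (x : M) :
    Module.Dual ℝ (TangentSpace (𝓡 n) x) :=
  (mfderiv (𝓡 n) 𝓘(ℝ, ℝ) f x).toLinearMap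

/-- The function `x ↦ P_x(df₁, …, df_r)`, normalized by
`(v₁ ∧ ⋯ ∧ v_r)(ξ₁, …, ξ_r) = det (ξ_j(v_i))`. -/
def MultivectorField.eval {n : ℕ} {M : Type u} [TopologicalSpace M]
    [ChartedSpace (EuclideanSpace ℝ (Fin n)) M] {r : ℕ}
    (P : MultivectorField n M r) (f : Fin r → M → ℝ) (x : M) : ℝ :=
  exteriorPower.pairingDual ℝ (TangentSpace (𝓡 n) x) r
    (exteriorPower.ιMulti ℝ r fun i => covector (f i) x) (P x)

/-- Smoothness of a multivector field on `U`: it has smooth values on smooth functions defined on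
open subsets of `U`. Taking coordinate functions, these values are the local coefficients. -/
def MultivectorField.SmoothOn {n : ℕ} {M : Type u} [TopologicalSpace M]
    [ChartedSpace (EuclideanSpace ℝ (Fin n)) M] {r : ℕ}
    (P : MultivectorField n M r) (U : Set M) : Prop :=
  ∀ V : Set M, IsOpen V → V ⊆ U → ∀ f : Fin r → M → ℝ,
    (∀ i, ContMDiffOn (𝓡 n) 𝓘(ℝ, ℝ) ∞ (f i) V) →
      ContMDiffOn (𝓡 n) 𝓘(ℝ, ℝ) ∞ (P.eval f) V

/-- The `k`-th wedge power of an element of `⋀² V`. -/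
def wedgePow {V : Type v} [AddCommGroup V] [Module ℝ V] (p : ⋀[ℝ]^2 V) (k : ℕ) :
    ⋀[ℝ]^(2 * k) V :=
  ⟨(p : ExteriorAlgebra ℝ V) ^ k, by
    change _ ∈ LinearMap.range (ExteriorAlgebra.ι ℝ : V →ₗ[ℝ] _) ^ (2 * k)
    rw [pow_mul]
    exact Submodule.pow_mem_pow _ p.2 k⟩

/-! ## Poisson structures -/

/-- The bracket `{f, g} = π(df, dg)`. -/
def poissonBracket {n : ℕ} {M : Type u} [TopologicalSpace M]
    [ChartedSpace (EuclideanSpace ℝ (Fin n)) M]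
    (π : MultivectorField n M 2) (f g : M → ℝ) : M → ℝ :=
  π.eval ![f, g]

/-- A Poisson structure: a smooth bivector field whose bracket satisfies the Jacobi identity on
smooth functions (on `M` and on open subsets of `M`). -/
structure IsPoisson {n : ℕ} {M : Type u} [TopologicalSpace M]
    [ChartedSpace (EuclideanSpace ℝ (Fin n)) M] (π : MultivectorField n M 2) : Prop where
  smooth : π.SmoothOn Set.univ
  jacobi : ∀ V : Set M, IsOpen V → ∀ f g h : M → ℝ,
    ContMDiffOn (𝓡 n) 𝓘(ℝ, ℝ) ∞ f V → ContMDiffOn (𝓡 n) 𝓘(ℝ, ℝ) ∞ g V →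
    ContMDiffOn (𝓡 n) 𝓘(ℝ, ℝ) ∞ h V → ∀ x ∈ V,
      poissonBracket π f (poissonBracket π g h) x + poissonBracket π g (poissonBracket π h f) x
        + poissonBracket π h (poissonBracket π f g) x = 0

/-! ## Line subbundles of `⋀^r TM` and transversality to the zero section -/

/-- `σ` is a smooth frame over the open set `U` of the family of lines `K ⊆ ⋀^r TM`. -/
structure IsLocalFrame {n : ℕ} {M : Type u} [TopologicalSpace M]
    [ChartedSpace (EuclideanSpace ℝ (Fin n)) M] {r : ℕ}
    (K : ∀ x : M, Submodule ℝ (⋀[ℝ]^r (TangentSpace (𝓡 n) x)))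
    (U : Set M) (σ : MultivectorField n M r) : Prop where
  isOpen : IsOpen U
  smooth : σ.SmoothOn U
  ne_zero : ∀ y ∈ U, σ y ≠ 0
  span_eq : ∀ y ∈ U, K y = Submodule.span ℝ {σ y}

/-- `K` is a smooth rank one vector subbundle of `⋀^r TM`. -/
def IsLineSubbundle {n : ℕ} {M : Type u} [TopologicalSpace M]
    [ChartedSpace (EuclideanSpace ℝ (Fin n)) M] {r : ℕ}
    (K : ∀ x : M, Submodule ℝ (⋀[ℝ]^r (TangentSpace (𝓡 n) x))) : Prop :=
  ∀ x : M, ∃ (U : Set M) (σ : MultivectorField n M r), x ∈ U ∧ IsLocalFrame K U σ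

/-- The section `s` of the line bundle `K` is transverse to the zero section. At a zero `x`, use a
frame `σ` near `x` to identify `K` with `U × ℝ` and `s` with a function `f`; then the tangent space
of the total space at `x` is `T_xM × ℝ`, the graph of `s` has as tangent space the graph of `df_x`,
the zero section has tangent space `T_xM × 0`, and the two must span. -/
def IsTransverseToZero {n : ℕ} {M : Type u} [TopologicalSpace M]
    [ChartedSpace (EuclideanSpace ℝ (Fin n)) M] {r : ℕ}
    (K : ∀ x : M, Submodule ℝ (⋀[ℝ]^r (TangentSpace (𝓡 n) x)))
    (s : MultivectorField n M r) : Prop :=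
  ∀ x : M, s x = 0 → ∃ (U : Set M) (σ : MultivectorField n M r) (f : M → ℝ),
    x ∈ U ∧ IsLocalFrame K U σ ∧ (∀ y ∈ U, s y = f y • σ y) ∧
      LinearMap.graph (covector (n := n) f x) ⊔
        Submodule.prod (⊤ : Submodule ℝ (TangentSpace (𝓡 n) x)) (⊥ : Submodule ℝ ℝ) = ⊤

/-! ## Log symplectic and log-f symplectic structures -/

/-- A log symplectic structure on a manifold of dimension `2m`: a Poisson structure such that
`⋀^m π`, a section of the line bundle `⋀^{2m} TM`, is transverse to the zero section. -/
structure IsLogSymplectic {m : ℕ} {M : Type u} [TopologicalSpace M]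
    [ChartedSpace (EuclideanSpace ℝ (Fin (2 * m))) M]
    (π : MultivectorField (2 * m) M 2) : Prop where
  poisson : IsPoisson π
  transverse : IsTransverseToZero (fun _ => ⊤) (fun x => wedgePow (π x) m)

/-- `π` is log-f symplectic. The integer `k` is the one with `⋀^k π ≢ 0` and `⋀^{k+1} π ≡ 0`, and
`K ⊆ ⋀^{2k} TM` is the line subbundle containing `⋀^k π`; both are determined by `π`. -/
structure IsLogFSymplectic {n : ℕ} {M : Type u} [TopologicalSpace M]
    [ChartedSpace (EuclideanSpace ℝ (Fin n)) M] (π : MultivectorField n M 2) (k : ℕ)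
    (K : ∀ x : M, Submodule ℝ (⋀[ℝ]^(2 * k) (TangentSpace (𝓡 n) x))) : Prop where
  poisson : IsPoisson π
  ne_zero : ∃ x, π x ≠ 0
  pow_ne_zero : ∃ x, wedgePow (π x) k ≠ 0
  pow_succ_eq_zero : ∀ x, wedgePow (π x) (k + 1) = 0
  lineSubbundle : IsLineSubbundle K
  mem : ∀ x, wedgePow (π x) k ∈ K x
  transverse : IsTransverseToZero K (fun x => wedgePow (π x) k)

/-- The distribution `D` with `⋀^r D = K`: the vectors `v` with `v ∧ κ = 0` for all `κ ∈ K`.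
If `K_x` is spanned by a decomposable `w₁ ∧ ⋯ ∧ w_r ≠ 0`, this is `span {w₁, …, w_r}`. -/
def assocDistribution {n : ℕ} {M : Type u} [TopologicalSpace M]
    [ChartedSpace (EuclideanSpace ℝ (Fin n)) M] {r : ℕ}
    (K : ∀ x : M, Submodule ℝ (⋀[ℝ]^r (TangentSpace (𝓡 n) x))) (x : M) :
    Submodule ℝ (TangentSpace (𝓡 n) x) where
  carrier := {v | ∀ κ ∈ K x, ExteriorAlgebra.ι ℝ v *
    (κ : ExteriorAlgebra ℝ (TangentSpace (𝓡 n) x)) = 0}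
  zero_mem' := by
    intro κ _
    rw [map_zero, zero_mul]
  add_mem' := by
    intro a b ha hb κ hκ
    rw [map_add, add_mul, ha κ hκ, hb κ hκ, add_zero]
  smul_mem' := by
    intro c a ha κ hκ
    rw [map_smul, smul_mul_assoc, ha κ hκ, smul_zero]

/-! ## Leaves and the leaf space -/

/-- The smooth map `j : P → M` is tangent to `D` with all of `D` as image of its differential. -/
def HasTangent {n d : ℕ} {M : Type u} [TopologicalSpace M]
    [ChartedSpace (EuclideanSpace ℝ (Fin n)) M]
    (D : ∀ x : M, Submodule ℝ (TangentSpace (𝓡 n) x))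
    {P : Type v} [TopologicalSpace P] [ChartedSpace (EuclideanSpace ℝ (Fin d)) P]
    (j : P → M) : Prop :=
  ∀ p : P, LinearMap.range (mfderiv (𝓡 d) (𝓡 n) j p).toLinearMap = D (j p)

/-- `L ⊆ M` is a connected integral manifold of `D`, of dimension `d`: the image of an injectively
immersed connected manifold whose tangent spaces are those of `D`. -/
def IsIntegralManifold {n : ℕ} {M : Type u} [TopologicalSpace M]
    [ChartedSpace (EuclideanSpace ℝ (Fin n)) M] (d : ℕ)
    (D : ∀ x : M, Submodule ℝ (TangentSpace (𝓡 n) x)) (L : Set M) : Prop :=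
  ∃ (P : Type u) (_ : TopologicalSpace P) (_ : T2Space P) (_ : SecondCountableTopology P)
    (_ : ConnectedSpace P) (_ : ChartedSpace (EuclideanSpace ℝ (Fin d)) P)
    (_ : IsManifold (𝓡 d) ∞ P) (j : P → M),
      Manifold.IsImmersion (𝓡 d) (𝓡 n) ∞ j ∧ Function.Injective j ∧ Set.range j = L ∧
        HasTangent (d := d) D j

/-- A leaf of `D`: a maximal connected integral manifold. -/
def IsLeaf {n : ℕ} {M : Type u} [TopologicalSpace M]
    [ChartedSpace (EuclideanSpace ℝ (Fin n)) M] (d : ℕ)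
    (D : ∀ x : M, Submodule ℝ (TangentSpace (𝓡 n) x)) (L : Set M) : Prop :=
  Maximal (IsIntegralManifold d D) L

/-- The manifold `B` with `pr : M → B` is the quotient `M/D` of `M` by the foliation integrating
`D` (the fibres of `pr` are precisely the leaves), and `pr` is a submersion. -/
structure IsLeafSpace {n q : ℕ} {M : Type u} [TopologicalSpace M]
    [ChartedSpace (EuclideanSpace ℝ (Fin n)) M] (d : ℕ)
    (D : ∀ x : M, Submodule ℝ (TangentSpace (𝓡 n) x))
    {B : Type v} [TopologicalSpace B] [ChartedSpace (EuclideanSpace ℝ (Fin q)) B]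
    (pr : M → B) : Prop where
  leaf_iff : ∀ L : Set M, IsLeaf d D L ↔ ∃ c : B, L = pr ⁻¹' {c}
  submersion : Manifold.IsSubmersion (𝓡 n) (𝓡 q) ∞ pr

/-- A subset of a manifold has measure zero: its image in every smooth chart is Lebesgue null. -/
def HasMeasureZero {q : ℕ} {B : Type v} [TopologicalSpace B]
    [ChartedSpace (EuclideanSpace ℝ (Fin q)) B] (X : Set B) : Prop :=
  ∀ e ∈ IsManifold.maximalAtlas (𝓡 q) ∞ B, MeasureTheory.volume (e '' (e.source ∩ X)) = 0

/-- The leaf `L`, as an embedded submanifold of `M` of dimension `2k` with tangent spaces `D`,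
carries a bivector field `πL` which is the restriction of `π` (its push-forward under the inclusion
is `π` along `L`), and `πL` is log symplectic. -/
def IsLogSymplecticLeaf {n : ℕ} {M : Type u} [TopologicalSpace M]
    [ChartedSpace (EuclideanSpace ℝ (Fin n)) M] (π : MultivectorField n M 2) (k : ℕ)
    (D : ∀ x : M, Submodule ℝ (TangentSpace (𝓡 n) x)) (L : Set M) : Prop :=
  ∃ (_ : ChartedSpace (EuclideanSpace ℝ (Fin (2 * k))) L) (_ : IsManifold (𝓡 (2 * k)) ∞ L)
    (πL : MultivectorField (2 * k) L 2),
      Manifold.IsSmoothEmbedding (𝓡 (2 * k)) (𝓡 n) ∞ (Subtype.val : L → M) ∧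
      HasTangent (d := 2 * k) D (Subtype.val : L → M) ∧
      (∀ p : L, exteriorPower.map 2
        (mfderiv (𝓡 (2 * k)) (𝓡 n) (Subtype.val : L → M) p).toLinearMap (πL p) = π p) ∧
      IsLogSymplectic πL

end

/-! The leaves are the fibres of `pr`, and `D` is the kernel of its differential
(`IsLeafSpace.exists_chart_and_eq_ker`). The bivector π is tangent to `D`. At a point where ⋀^k π ≠
0, contracting ⋀^{k+1} π = 0 with a covector α gives (k+1) π♯α ∧ ⋀^k π = 0, hence π♯α ∈ `D`
(`pairingDual_eq_zero_of_wedgePow_succ_eq_zero`). By transversality such points are dense, and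
tangency to the fibres is a closed condition, so it holds everywhere
(`IsLogFSymplectic.isTangentTo_ker`). The same argument applies to a local frame σ of `K` with ⋀^k π
= f σ. So π and σ both restrict to each leaf P, the restriction of π is again Poisson, and ⋀^k π_P =
f|_P σ|_P. Therefore P is log symplectic as soon as df is nonzero on `D` at every zero of ⋀^k π on P
(`IsLogFSymplectic.isLogSymplecticLeaf`).

The exceptional set is thus the image of `tangencyLocus`: the points of the regular hypersurface Z =
{f = 0} where `D` ⊆ TZ, which are the critical points of pr|_Z. That it is null is Sard's theorem
for pr|_Z. The hypersurface structure reduces this to real-valued functions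
(`measure_image_fst_vertical_critical`). In product coordinates E × F, df vanishes on F at a
critical point, so df(a, 0) ≠ 0 for some a ∈ E. Over each line in E of direction a, the critical
values are critical values of a real function on a parametrized hypersurface of ℝ × F, hence null,
and Fubini along a concludes. Real-valued Sard (`volume_image_critical_eq_zero`) goes by induction
on the dimension, with a Hausdorff dimension estimate where the function is flat to high order. -/

/-! ## Sard's theorem for real-valued functions -/

section Sard

open MeasureTheory Set Topology

/-- The inverse function theorem on an open set, in the smooth category. -/
theorem exists_openPartialHomeomorph_of_contDiffOn {E F : Type*} [NormedAddCommGroup E]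
    [NormedSpace ℝ E] [CompleteSpace E] [NormedAddCommGroup F] [NormedSpace ℝ F]
    {Φ : E → F} {W : Set E} (hW : IsOpen W) (hΦ : ContDiffOn ℝ ∞ Φ W) {a : E} (ha : a ∈ W)
    (A : E ≃L[ℝ] F) (hA : fderiv ℝ Φ a = A) :
    ∃ e : OpenPartialHomeomorph E F, a ∈ e.source ∧ e.source ⊆ W ∧ (∀ x, e x = Φ x) ∧
      ContDiffOn ℝ ∞ e.symm e.target := by
  have hat : ContDiffAt ℝ ∞ Φ a := hΦ.contDiffAt (hW.mem_nhds ha)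
  have hda : HasFDerivAt Φ (A : E →L[ℝ] F) a := by
    rw [← hA]; exact (hat.differentiableAt (by simp)).hasFDerivAt
  let e₀ := hat.toOpenPartialHomeomorph Φ hda (by simp)
  -- The source is shrunk to the open set where the derivative is invertible, so that the inverse is
  -- smooth at every point of the target and not only at the image of `a`.
  have hO : IsOpen (W ∩ fderiv ℝ Φ ⁻¹' range ((↑) : (E ≃L[ℝ] F) → (E →L[ℝ] F))) :=
    (hΦ.continuousOn_fderiv_of_isOpen hW (by simp)).isOpen_inter_preimage hW
      (ContinuousLinearEquiv.isOpen)
  let O := W ∩ fderiv ℝ Φ ⁻¹' range ((↑) : (E ≃L[ℝ] F) → (E →L[ℝ] F))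
  have hsrc : (e₀.restrOpen O hO).source = e₀.source ∩ O := rfl
  refine ⟨e₀.restrOpen O hO, ?_, ?_, fun x => rfl, ?_⟩
  · exact ⟨hat.mem_toOpenPartialHomeomorph_source hda (by simp), ha, A, hA.symm⟩
  · rw [hsrc]; exact fun x hx => hx.2.1
  · intro y hy
    have hx := (e₀.restrOpen O hO).map_target hy
    rw [hsrc] at hx
    obtain ⟨-, hxW, B, hB⟩ := hx
    have hxat : ContDiffAt ℝ ∞ Φ ((e₀.restrOpen O hO).symm y) := hΦ.contDiffAt (hW.mem_nhds hxW)
    refine ((e₀.restrOpen O hO).contDiffAt_symm (f₀' := B) hy ?_ hxat).contDiffWithinAt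
    rw [hB]
    exact (hxat.differentiableAt (by simp)).hasFDerivAt

/-- A smooth regular level hypersurface is locally parametrized by a smooth map. -/
theorem exists_parametrization_of_fderiv_ne_zero {F : Type*} [NormedAddCommGroup F]
    [NormedSpace ℝ F] [FiniteDimensional ℝ F] {W : Set F} (hW : IsOpen W) {w : F → ℝ}
    (hw : ContDiffOn ℝ ∞ w W) {a : F} (ha : a ∈ W) (hd : fderiv ℝ w a ≠ 0) :
    ∃ (O : Set (fderiv ℝ w a).ker) (ψ : (fderiv ℝ w a).ker → F), IsOpen O ∧
      ContDiffOn ℝ ∞ ψ O ∧ MapsTo ψ O W ∧ (∀ z ∈ O, w (ψ z) = w a) ∧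
      ∃ N ∈ 𝓝 a, ∀ y ∈ N, w y = w a → y ∈ ψ '' O := by
  have := FiniteDimensional.complete ℝ F
  set ℓ := fderiv ℝ w a with hℓ
  obtain ⟨P, hP⟩ := ℓ.ker_closedComplemented_of_finiteDimensional_range
  have hℓr : ℓ.range = ⊤ := by
    exact LinearMap.range_eq_top.2 (LinearMap.surjective fun h =>
      hd (ContinuousLinearMap.ext fun x => DFunLike.congr_fun h x))
  have hPr : P.range = ⊤ := LinearMap.range_eq_top.2 fun x => ⟨x, hP x⟩
  have hc : IsCompl ℓ.ker P.ker := by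
    exact LinearMap.isCompl_of_proj hP
  -- With `P` a projection onto the kernel of dw, the map y ↦ (w y, P y) is a local diffeomorphism
  -- at `a`; its inverse restricted to {w a} × ker is the parametrization.
  let A := ContinuousLinearMap.equivProdOfSurjectiveOfIsCompl ℓ P hℓr hPr hc
  have hat : ContDiffAt ℝ ∞ w a := hw.contDiffAt (hW.mem_nhds ha)
  have hdA : fderiv ℝ (fun y => (w y, P y)) a = A := by
    have h1 : HasFDerivAt w ℓ a := (hat.differentiableAt (by simp)).hasFDerivAt
    exact (h1.prodMk P.hasFDerivAt).fderiv
  obtain ⟨e, hae, heW, he, hes⟩ := exists_openPartialHomeomorph_of_contDiffOn hW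
    (hw.prodMk P.contDiff.contDiffOn) ha A hdA
  have hcont : Continuous fun z : ℓ.ker => (w a, z) := by fun_prop
  refine ⟨(fun z => (w a, z)) ⁻¹' e.target, fun z => e.symm (w a, z),
    e.open_target.preimage hcont, ?_, ?_, ?_, e.source, e.open_source.mem_nhds hae, ?_⟩
  · exact hes.comp (by fun_prop) (fun z hz => hz)
  · exact fun z hz => heW (e.map_target hz)
  · intro z hz
    have h := he (e.symm (w a, z))
    rw [e.right_inv hz] at h
    exact (congrArg Prod.fst h).symm
  · intro y hy hya
    have h := he y
    rw [hya] at h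
    refine ⟨P y, ?_, ?_⟩
    · change (w a, P y) ∈ e.target
      rw [← h]; exact e.map_source hy
    · change e.symm (w a, P y) = y
      rw [← h, e.left_inv hy]

/-- Countably many of the given neighbourhoods cover `S`, by second countability. This is what makes
all later measure estimates local. -/
theorem measure_image_eq_zero_of_locally {X Y : Type*} [TopologicalSpace X]
    [SecondCountableTopology X] [MeasurableSpace Y] (μ : Measure Y) (f : X → Y) (S : Set X)
    (h : ∀ x ∈ S, ∃ N ∈ 𝓝 x, μ (f '' (S ∩ N)) = 0) : μ (f '' S) = 0 := by
  choose! N hN hμ using h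
  obtain ⟨t, htS, htc, htU⟩ := TopologicalSpace.countable_cover_nhdsWithin (s := S)
    (fun x hx => mem_nhdsWithin_of_mem_nhds (hN x hx))
  have : f '' S ⊆ ⋃ x ∈ t, f '' (S ∩ N x) := by
    rintro _ ⟨x, hx, rfl⟩
    obtain ⟨y, hy, hxy⟩ := mem_iUnion₂.1 (htU hx)
    exact mem_iUnion₂.2 ⟨y, hy, x, ⟨hx, hxy⟩, rfl⟩
  exact measure_mono_null this ((measure_biUnion_null_iff htc).2 fun x hx => hμ x (htS hx))

/-- Taylor's estimate at a point where the derivatives of orders `1, …, k` vanish. -/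
theorem norm_sub_le_of_iteratedFDeriv_eq_zero {F : Type} [NormedAddCommGroup F]
    [NormedSpace ℝ F] {B : Set F} (hB : IsOpen B) (hc : Convex ℝ B) {K : ℝ} (hK : 0 ≤ K)
    (k : ℕ) : ∀ {G : Type} [NormedAddCommGroup G] [NormedSpace ℝ G] {g : F → G},
    ContDiffOn ℝ ∞ g B → (∀ z ∈ B, ‖iteratedFDeriv ℝ (k + 1) g z‖ ≤ K) → ∀ x ∈ B,
    (∀ i, 1 ≤ i → i ≤ k → iteratedFDeriv ℝ i g x = 0) → ∀ y ∈ B,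
    ‖g y - g x‖ ≤ K * ‖y - x‖ ^ (k + 1) := by
  induction k with
  | zero =>
    intro G _ _ g hg hb x hx _ y hy
    rw [zero_add, pow_one]
    refine hc.norm_image_sub_le_of_norm_fderiv_le (𝕜 := ℝ) (fun z hz =>
      (hg.contDiffAt (hB.mem_nhds hz)).differentiableAt (by simp)) (fun z hz => ?_) hx hy
    have := hb z hz
    rwa [zero_add, norm_iteratedFDeriv_one] at this
  | succ k ih =>
    intro G _ _ g hg hb x hx h0 y hy
    have hg' : ContDiffOn ℝ ∞ (fderiv ℝ g) B := hg.fderiv_of_isOpen hB (by simp)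
    -- The induction is applied to the derivative of `g`, which is why the target space `G` varies
    -- in the statement.
    have key := ih hg' (fun z hz => by rw [norm_iteratedFDeriv_fderiv]; exact hb z hz) x hx
      (fun i h1 h2 => by
        rw [← norm_eq_zero, norm_iteratedFDeriv_fderiv, h0 (i + 1) (by omega) (by omega),
          norm_zero])
    have hgx : fderiv ℝ g x = 0 := by
      rw [← norm_eq_zero, ← norm_iteratedFDeriv_one, h0 1 le_rfl (by omega), norm_zero]
    -- On this smaller convex set the bound K‖z - x‖^(k+1) on the derivative is at most the constant
    -- K‖y - x‖^(k+1), so the mean value inequality gains one power.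
    have hc' : Convex ℝ (B ∩ Metric.closedBall x ‖y - x‖) :=
      hc.inter (convex_closedBall _ _)
    have := hc'.norm_image_sub_le_of_norm_fderiv_le (𝕜 := ℝ) (f := g)
      (C := K * ‖y - x‖ ^ (k + 1)) (fun z hz =>
      (hg.contDiffAt (hB.mem_nhds hz.1)).differentiableAt (by simp)) (fun z hz => ?_)
      ⟨hx, Metric.mem_closedBall_self (norm_nonneg _)⟩
      ⟨hy, by rw [Metric.mem_closedBall, dist_eq_norm]⟩
    · calc ‖g y - g x‖ ≤ K * ‖y - x‖ ^ (k + 1) * ‖y - x‖ := this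
        _ = K * ‖y - x‖ ^ (k + 1 + 1) := by ring
    · have h := key z hz.1
      rw [hgx, sub_zero] at h
      refine h.trans ?_
      have hz2 : ‖z - x‖ ≤ ‖y - x‖ := by
        have := hz.2
        rwa [Metric.mem_closedBall, dist_eq_norm] at this
      gcongr

/-- The image of the points where all derivatives up to the order of the dimension vanish. -/
theorem volume_image_flat_eq_zero {F : Type} [NormedAddCommGroup F] [NormedSpace ℝ F]
    [FiniteDimensional ℝ F] {W : Set F} (hW : IsOpen W) {g : F → ℝ} (hg : ContDiffOn ℝ ∞ g W) :
    volume (g '' {y ∈ W | ∀ i, 1 ≤ i → i ≤ Module.finrank ℝ F → iteratedFDeriv ℝ i g y = 0})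
      = 0 := by
  set d := Module.finrank ℝ F
  set S := {y ∈ W | ∀ i, 1 ≤ i → i ≤ d → iteratedFDeriv ℝ i g y = 0}
  have : ProperSpace F := FiniteDimensional.proper ℝ F
  -- By Taylor's estimate `g` is locally Hölder of exponent d + 1 on `S`. Hence the image has
  -- dimension at most d / (d + 1) < 1, and its one-dimensional Hausdorff measure, which is Lebesgue
  -- measure, vanishes.
  have hdim : dimH (g '' S) ≤ dimH S / ((d + 1 : ℕ) : NNReal) := by
    refine dimH_image_le_of_locally_holder_on (by positivity) fun x hx => ?_
    have hcont : ContinuousAt (fun z => ‖iteratedFDeriv ℝ (d + 1) g z‖) x := by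
      have : ContDiffAt ℝ 0 (iteratedFDeriv ℝ (d + 1) g) x :=
        (hg.contDiffAt (hW.mem_nhds hx.1)).iteratedFDeriv_right (m := 0)
          (by simpa using WithTop.coe_le_coe.2 (OrderTop.le_top ((d + 1 : ℕ) : ℕ∞)))
      exact this.continuousAt.norm
    set K := ‖iteratedFDeriv ℝ (d + 1) g x‖ + 1
    have hK : 0 ≤ K := by positivity
    have hnear : ∀ᶠ z in 𝓝 x, ‖iteratedFDeriv ℝ (d + 1) g z‖ ≤ K ∧ z ∈ W := by
      refine Filter.Eventually.and ?_ (hW.mem_nhds hx.1)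
      exact (hcont.eventually (gt_mem_nhds (lt_add_one _))).mono fun z hz => hz.le
    obtain ⟨ε, hε, hball⟩ := Metric.eventually_nhds_iff_ball.1 hnear
    refine ⟨K.toNNReal, S ∩ Metric.ball x ε,
      inter_mem_nhdsWithin _ (Metric.ball_mem_nhds x hε), ?_⟩
    intro y hy z hz
    have := norm_sub_le_of_iteratedFDeriv_eq_zero Metric.isOpen_ball (convex_ball x ε) hK d
      (hg.mono fun z hz => (hball z hz).2) (fun z hz => (hball z hz).1) z hz.2 hz.1.2 y hy.2
    rw [edist_dist, edist_dist, NNReal.coe_natCast, ENNReal.rpow_natCast, dist_eq_norm,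
      dist_eq_norm, ← ENNReal.ofReal_pow (norm_nonneg _)]
    change _ ≤ ENNReal.ofReal K * _
    rw [← ENNReal.ofReal_mul hK]
    exact ENNReal.ofReal_le_ofReal this
  have hS : dimH S ≤ d := (dimH_mono (subset_univ S)).trans_eq (Real.dimH_univ_eq_finrank F)
  have hlt : dimH (g '' S) < (1 : NNReal) := by
    refine (hdim.trans (ENNReal.div_le_div_right hS _)).trans_lt ?_
    rw [ENNReal.div_lt_iff (by simp) (by simp)]
    norm_cast
    simp
  have := hausdorffMeasure_of_dimH_lt hlt
  rwa [NNReal.coe_one, hausdorffMeasure_real] at this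

/-- Sard's theorem for smooth real-valued functions. -/
theorem volume_image_critical_eq_zero (m : ℕ) : ∀ (F : Type) [NormedAddCommGroup F]
    [NormedSpace ℝ F] [FiniteDimensional ℝ F], Module.finrank ℝ F = m → ∀ (W : Set F),
    IsOpen W → ∀ g : F → ℝ, ContDiffOn ℝ ∞ g W →
    volume (g '' {y ∈ W | fderiv ℝ g y = 0}) = 0 := by
  induction m with
  | zero =>
    intro F _ _ _ hF W hW g hg
    have := Module.finrank_zero_iff.1 hF
    exact (Set.Subsingleton.image (subsingleton_of_subsingleton) g).measure_zero _
  | succ m ih =>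
    intro F _ _ _ hF W hW g hg
    set Z : ℕ → Set F := fun j => {y ∈ W | ∀ i, 1 ≤ i → i ≤ j → iteratedFDeriv ℝ i g y = 0}
    -- Near a point of `Z j \ Z (j + 1)`, some component of the `j`-th derivative vanishes on `Z j`
    -- but has nonzero differential. So `Z j` lies locally in a smooth hypersurface. As j ≥ 1, its
    -- points stay critical for `g` composed with the parametrization, and the induction hypothesis
    -- in dimension `m` applies.
    have hstep : ∀ j, 1 ≤ j → volume (g '' (Z j \ Z (j + 1))) = 0 := by
      intro j hj
      refine measure_image_eq_zero_of_locally _ _ _ fun x hx => ?_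
      have hxW := hx.1.1
      have hne : iteratedFDeriv ℝ (j + 1) g x ≠ 0 := by
        intro h0
        refine hx.2 ⟨hxW, fun i h1 h2 => ?_⟩
        rcases Nat.le_succ_iff.1 h2 with h | h
        · exact hx.1.2 i h1 h
        · rw [h]; exact h0
      have hne' : fderiv ℝ (iteratedFDeriv ℝ j g) x ≠ 0 := by
        intro h0
        apply hne
        have h1 := norm_fderiv_iteratedFDeriv (𝕜 := ℝ) (f := g) (x := x) (n := j)
        rw [← norm_eq_zero, ← h1, h0]
        exact norm_zero (E := F →L[ℝ] F [×j]→L[ℝ] ℝ)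
      obtain ⟨v, hv⟩ : ∃ v, fderiv ℝ (iteratedFDeriv ℝ j g) x v ≠ 0 := by
        by_contra! h
        exact hne' (ContinuousLinearMap.ext h)
      obtain ⟨u, hu⟩ : ∃ u, fderiv ℝ (iteratedFDeriv ℝ j g) x v u ≠ 0 := by
        by_contra! h
        exact hv (ContinuousMultilinearMap.ext h)
      have hsm : ContDiffOn ℝ ∞ (iteratedFDeriv ℝ j g) W := fun z hz =>
        ((hg.contDiffAt (hW.mem_nhds hz)).iteratedFDeriv_right (m := ∞)
          (by exact_mod_cast le_top)).contDiffWithinAt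
      let ev := ContinuousMultilinearMap.apply ℝ (fun _ : Fin j => F) ℝ u
      have hw : ContDiffOn ℝ ∞ (fun y => ev (iteratedFDeriv ℝ j g y)) W :=
        ev.contDiff.comp_contDiffOn hsm
      have hd : fderiv ℝ (fun y => ev (iteratedFDeriv ℝ j g y)) x ≠ 0 := by
        have h1 : HasFDerivAt (fun y => ev (iteratedFDeriv ℝ j g y)) _ x :=
          ev.hasFDerivAt.comp x (((hsm.contDiffAt (hW.mem_nhds hxW)).differentiableAt
            (by simp)).hasFDerivAt)
        rw [h1.fderiv]
        intro h0
        exact hu (by simpa [ev] using DFunLike.congr_fun h0 v)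
      obtain ⟨O, ψ, hO, hψ, hmaps, -, N, hN, hcov⟩ :=
        exists_parametrization_of_fderiv_ne_zero hW hw hxW hd
      refine ⟨N, hN, measure_mono_null ?_ (ih _ ?_ O hO (g ∘ ψ) (hg.comp hψ hmaps))⟩
      · rintro _ ⟨y, ⟨hyZ, hyN⟩, rfl⟩
        have hwz : ∀ y ∈ Z j, ev (iteratedFDeriv ℝ j g y) = 0 := fun y hy => by
          rw [hy.2 j hj le_rfl, map_zero]
        obtain ⟨z, hz, rfl⟩ := hcov y hyN (by rw [hwz y hyZ.1, hwz x hx.1])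
        refine ⟨z, ⟨hz, ?_⟩, rfl⟩
        have h0 : fderiv ℝ g (ψ z) = 0 := by
          rw [← norm_eq_zero, ← norm_iteratedFDeriv_one, hyZ.1.2 1 le_rfl hj, norm_zero]
        rw [fderiv_comp _ ((hg.contDiffAt (hW.mem_nhds (hmaps hz))).differentiableAt (by simp))
          ((hψ.contDiffAt (hO.mem_nhds hz)).differentiableAt (by simp)), h0,
          ContinuousLinearMap.zero_comp]
      · have h1 := (fderiv ℝ (fun y => ev (iteratedFDeriv ℝ j g y)) x).finrank_range_add_finrank_ker
        have h2 : Module.finrank ℝ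
            (fderiv ℝ (fun y => ev (iteratedFDeriv ℝ j g y)) x).range = 1 := by
          rw [LinearMap.range_eq_top.2 (LinearMap.surjective fun h =>
            hd (ContinuousLinearMap.ext fun x => DFunLike.congr_fun h x)), finrank_top,
            Module.finrank_self]
        omega
    have hflat := volume_image_flat_eq_zero hW hg
    rw [hF] at hflat
    -- Telescoping from `Z 1`, the full critical set, to `Z (m + 1)`, where the flat estimate takes
    -- over because m + 1 is the dimension of `F`.
    have hcov : ∀ j, 1 ≤ j → volume (g '' Z 1 \ g '' Z j) = 0 := by
      intro j hj
      induction j, hj using Nat.le_induction with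
      | base => simp
      | succ j hj ih' =>
        refine measure_mono_null ?_ (measure_union_null ih' (hstep j hj))
        rintro _ ⟨⟨y, hy, rfl⟩, hn⟩
        by_cases h : g y ∈ g '' Z j
        · obtain ⟨z, hz, hzy⟩ := h
          exact Or.inr ⟨z, ⟨hz, fun hz' => hn ⟨z, hz', hzy⟩⟩, hzy⟩
        · exact Or.inl ⟨⟨y, hy, rfl⟩, h⟩
    refine measure_mono_null ?_ (measure_union_null (hcov (m + 1) (by omega)) hflat)
    rintro _ ⟨y, ⟨hyW, hy⟩, rfl⟩
    have hy1 : y ∈ Z 1 := ⟨hyW, fun i h1 h2 => by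
      obtain rfl : i = 1 := le_antisymm h2 h1
      rw [← norm_eq_zero, norm_iteratedFDeriv_one, hy, norm_zero]⟩
    by_cases h : g y ∈ g '' Z (m + 1)
    · exact Or.inr h
    · exact Or.inl ⟨⟨y, hy1, rfl⟩, h⟩

/-- For a regular level set in `ℝ × F`, the critical values of the first coordinate are null. -/
theorem volume_image_fst_vertical_critical_real {F : Type} [NormedAddCommGroup F]
    [NormedSpace ℝ F] [FiniteDimensional ℝ F] {W : Set (ℝ × F)} (hW : IsOpen W)
    {h : ℝ × F → ℝ} (hh : ContDiffOn ℝ ∞ h W) :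
    volume (Prod.fst '' {p ∈ W | h p = 0 ∧ (∀ v : F, fderiv ℝ h p (0, v) = 0) ∧
      fderiv ℝ h p ≠ 0}) = 0 := by
  refine measure_image_eq_zero_of_locally _ _ _ fun p hp => ?_
  obtain ⟨hpW, hp0, -, hpd⟩ := hp
  obtain ⟨O, ψ, hO, hψ, hmaps, hlev, N, hN, hcov⟩ :=
    exists_parametrization_of_fderiv_ne_zero hW hh hpW hpd
  refine ⟨N, hN, measure_mono_null ?_ (volume_image_critical_eq_zero _ _ rfl O hO
    (fun z => (ψ z).1) (contDiff_fst.comp_contDiffOn hψ))⟩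
  rintro _ ⟨q, ⟨⟨hqW, hq0, hqv, hqd⟩, hqN⟩, rfl⟩
  obtain ⟨z, hz, rfl⟩ := hcov q hqN (by rw [hq0, hp0])
  refine ⟨z, ⟨hz, ?_⟩, rfl⟩
  have hψd : HasFDerivAt ψ (fderiv ℝ ψ z) z :=
    ((hψ.contDiffAt (hO.mem_nhds hz)).differentiableAt (by simp)).hasFDerivAt
  have hhd : HasFDerivAt h (fderiv ℝ h (ψ z)) (ψ z) :=
    ((hh.contDiffAt (hW.mem_nhds hqW)).differentiableAt (by simp)).hasFDerivAt
  have hzero : (fderiv ℝ h (ψ z)).comp (fderiv ℝ ψ z) = 0 := by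
    have h1 := hhd.comp z hψd
    have h2 : HasFDerivAt (h ∘ ψ) (0 : _ →L[ℝ] ℝ) z :=
      (hasFDerivAt_const (h p) z).congr_of_eventuallyEq
        (Filter.eventuallyEq_of_mem (hO.mem_nhds hz) hlev)
    exact h1.unique h2
  -- At a vertical critical point dh = c dt with c ≠ 0. Since h ∘ ψ is constant, dh ∘ dψ = 0, which
  -- forces the differential of t ∘ ψ to vanish: `z` is a critical point of the first coordinate.
  have hform : ∀ v : ℝ × F, fderiv ℝ h (ψ z) v = v.1 * fderiv ℝ h (ψ z) (1, 0) := by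
    intro v
    have hv : v = v.1 • ((1 : ℝ), (0 : F)) + (0, v.2) := by ext <;> simp
    rw [congrArg (fderiv ℝ h (ψ z)) hv, map_add, map_smul, hqv, add_zero, smul_eq_mul]
  have hc : fderiv ℝ h (ψ z) (1, 0) ≠ 0 := by
    intro h0
    exact hqd (ContinuousLinearMap.ext fun v => by rw [hform, h0, mul_zero]; rfl)
  have : HasFDerivAt (fun z => (ψ z).1) ((ContinuousLinearMap.fst ℝ ℝ F).comp (fderiv ℝ ψ z)) z :=
    (ContinuousLinearMap.fst ℝ ℝ F).hasFDerivAt.comp z hψd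
  rw [this.fderiv]
  ext v
  have h3 := DFunLike.congr_fun hzero v
  rw [ContinuousLinearMap.comp_apply, hform] at h3
  exact (mul_eq_zero.1 h3).resolve_right hc

/-- For a smooth regular hypersurface `{f = 0}` of `E × F`, the set of critical values of its
projection to `E` is null. -/
theorem measure_image_fst_vertical_critical {E F : Type} [NormedAddCommGroup E]
    [NormedSpace ℝ E] [FiniteDimensional ℝ E] [MeasurableSpace E] [BorelSpace E]
    (μ : Measure E) [μ.IsAddHaarMeasure] [NormedAddCommGroup F]
    [NormedSpace ℝ F] [FiniteDimensional ℝ F] {W : Set (E × F)} (hW : IsOpen W)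
    {f : E × F → ℝ} (hf : ContDiffOn ℝ ∞ f W) :
    μ (Prod.fst '' {p ∈ W | f p = 0 ∧ (∀ v : F, fderiv ℝ f p (0, v) = 0) ∧
      fderiv ℝ f p ≠ 0}) = 0 := by
  have : ProperSpace E := FiniteDimensional.proper ℝ E
  have : ProperSpace F := FiniteDimensional.proper ℝ F
  refine measure_image_eq_zero_of_locally _ _ _ fun p hp => ?_
  obtain ⟨hpW, -, hpv, hpd⟩ := hp
  obtain ⟨a, ha⟩ : ∃ a : E, fderiv ℝ f p (a, 0) ≠ 0 := by
    by_contra! h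
    refine hpd (ContinuousLinearMap.ext fun v => ?_)
    have hv : v = (v.1, (0 : F)) + (0, v.2) := by simp
    rw [congrArg (fderiv ℝ f p) hv, map_add, h, hpv, add_zero]; rfl
  have hcont : ContinuousOn (fderiv ℝ f) W := hf.continuousOn_fderiv_of_isOpen hW (by simp)
  have hnear : ∀ᶠ q in 𝓝 p, q ∈ W ∧ fderiv ℝ f q (a, 0) ≠ 0 := by
    refine Filter.Eventually.and (hW.mem_nhds hpW) ?_
    have : ContinuousAt (fun q => fderiv ℝ f q (a, 0)) p :=
      (hcont.continuousAt (hW.mem_nhds hpW)).clm_apply continuousAt_const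
    exact this.eventually_ne ha
  obtain ⟨ε, hε, hball⟩ := Metric.nhds_basis_closedBall.eventually_iff.1 hnear
  -- The critical points in a closed ball form a compact set, so their projection is measurable, as
  -- Fubini requires. On the ball df(a, 0) ≠ 0, so regularity need not be listed as a condition in
  -- `T`.
  set T := Metric.closedBall p ε ∩ {q | f q = 0 ∧ ∀ v : F, fderiv ℝ f q (0, v) = 0}
  have hsub : Metric.closedBall p ε ⊆ W := fun q hq => (hball hq).1
  have hT : IsCompact T := by
    have hcl : IsClosed T := by
      have h1 : IsClosed (Metric.closedBall p ε ∩ f ⁻¹' {0}) :=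
        (hf.continuousOn.mono hsub).preimage_isClosed_of_isClosed Metric.isClosed_closedBall
          isClosed_singleton
      have h2 : ∀ v : F, IsClosed (Metric.closedBall p ε ∩ (fun q => fderiv ℝ f q (0, v)) ⁻¹' {0}) :=
        fun v => ((hcont.mono hsub).clm_apply continuousOn_const).preimage_isClosed_of_isClosed
          Metric.isClosed_closedBall isClosed_singleton
      have : T = (Metric.closedBall p ε ∩ f ⁻¹' {0}) ∩
          ⋂ v : F, (Metric.closedBall p ε ∩ (fun q => fderiv ℝ f q (0, v)) ⁻¹' {0}) := by
        ext q
        simp only [T, mem_inter_iff, mem_ofPred_eq, mem_preimage, mem_singleton_iff, mem_iInter]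
        exact ⟨fun h => ⟨⟨h.1, h.2.1⟩, fun v => ⟨h.1, h.2.2 v⟩⟩,
          fun h => ⟨h.1.1, h.1.2, fun v => (h.2 v).2⟩⟩
      rw [this]
      exact h1.inter (isClosed_iInter h2)
    exact (isCompact_closedBall p ε).of_isClosed_subset hcl inter_subset_left
  have hTm : MeasurableSet (Prod.fst '' T) := (hT.image continuous_fst).isClosed.measurableSet
  refine ⟨Metric.closedBall p ε, Metric.closedBall_mem_nhds p hε,
    measure_mono_null (t := Prod.fst '' T) ?_ ?_⟩
  · rintro _ ⟨q, ⟨⟨-, hq0, hqv, -⟩, hq⟩, rfl⟩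
    exact ⟨q, ⟨hq, hq0, hqv⟩, rfl⟩
  -- Pull `f` back along (t, v) ↦ (y + t a, v). The t-derivative of the pullback is df(a, 0) ≠ 0 at
  -- points of `T`, so the one-parameter case bounds the slice.
  have key : ∀ y : E, ∀ᵐ t : ℝ, y + LinearMap.toSpanSingleton ℝ E a t ∈ (Prod.fst '' T)ᶜ := by
    intro y
    let A : ℝ × F →L[ℝ] E × F :=
      ((ContinuousLinearMap.toSpanSingleton ℝ a).prodMap (ContinuousLinearMap.id ℝ F))
    let τ : ℝ × F → E × F := fun q => (y, 0) + A q
    have hτ : ContDiff ℝ ∞ τ := contDiff_const.add A.contDiff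
    have hτd : ∀ q, HasFDerivAt τ A q := fun q => A.hasFDerivAt.const_add _
    have hnull := volume_image_fst_vertical_critical_real (hW.preimage hτ.continuous)
      (hf.comp hτ.contDiffOn fun q hq => hq)
    refine measure_mono_null ?_ hnull
    intro t ht
    simp only [mem_compl_iff, not_not, mem_ofPred_eq] at ht
    obtain ⟨q, ⟨hq, hq0, hqv⟩, hqt⟩ := ht
    have hτq : τ (t, q.2) = q := by
      refine Prod.ext ?_ ?_
      · simpa [τ, A] using hqt.symm
      · simp [τ, A]
    have hfd : HasFDerivAt (f ∘ τ) ((fderiv ℝ f q).comp A) (t, q.2) := by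
      have h1 : HasFDerivAt f (fderiv ℝ f q) (τ (t, q.2)) := by
        rw [hτq]
        exact ((hf.contDiffAt (hW.mem_nhds (hsub hq))).differentiableAt (by simp)).hasFDerivAt
      exact h1.comp _ (hτd _)
    refine ⟨(t, q.2), ⟨?_, ?_, ?_, ?_⟩, rfl⟩
    · change τ (t, q.2) ∈ W
      rw [hτq]; exact hsub hq
    · change f (τ (t, q.2)) = 0
      rw [hτq]; exact hq0
    · intro v
      rw [hfd.fderiv]
      simpa [A] using hqv v
    · rw [hfd.fderiv]
      intro h0
      exact (hball hq).2 (by simpa [A] using DFunLike.congr_fun h0 (1, 0))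
  have := ae_mem_of_ae_add_linearMap_mem (LinearMap.toSpanSingleton ℝ E a) volume μ hTm.compl key
  rw [ae_iff] at this
  simp only [mem_compl_iff, not_not] at this
  exact this

end Sard

/-! ## Exterior powers -/

section Exterior

variable {V W : Type*} [AddCommGroup V] [Module ℝ V] [AddCommGroup W] [Module ℝ W]

theorem exteriorPower_coe_map (r : ℕ) (A : V →ₗ[ℝ] W) (P : ⋀[ℝ]^r V) :
    (exteriorPower.map r A P : ExteriorAlgebra ℝ W) = ExteriorAlgebra.map A P := by
  have : (⋀[ℝ]^r W).subtype ∘ₗ exteriorPower.map r A =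
      (ExteriorAlgebra.map A).toLinearMap ∘ₗ (⋀[ℝ]^r V).subtype := by
    refine exteriorPower.linearMap_ext (AlternatingMap.ext fun v => ?_)
    simp [ExteriorAlgebra.map_apply_ιMulti]
  exact DFunLike.congr_fun this P

theorem wedgePow_map (A : V →ₗ[ℝ] W) (p : ⋀[ℝ]^2 V) (k : ℕ) :
    wedgePow (exteriorPower.map 2 A p) k = exteriorPower.map (2 * k) A (wedgePow p k) := by
  refine Subtype.ext ?_
  rw [exteriorPower_coe_map]
  change (exteriorPower.map 2 A p : ExteriorAlgebra ℝ W) ^ k =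
    ExteriorAlgebra.map A ((p : ExteriorAlgebra ℝ V) ^ k)
  rw [exteriorPower_coe_map, map_pow]

theorem pairingDual_map {r : ℕ} (A : V →ₗ[ℝ] W) (ξ : Fin r → Module.Dual ℝ W) (P : ⋀[ℝ]^r V) :
    exteriorPower.pairingDual ℝ W r (exteriorPower.ιMulti ℝ r ξ) (exteriorPower.map r A P) =
      exteriorPower.pairingDual ℝ V r (exteriorPower.ιMulti ℝ r fun i => ξ i ∘ₗ A) P := by
  have : exteriorPower.pairingDual ℝ W r (exteriorPower.ιMulti ℝ r ξ) ∘ₗ exteriorPower.map r A =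
      exteriorPower.pairingDual ℝ V r (exteriorPower.ιMulti ℝ r fun i => ξ i ∘ₗ A) := by
    refine exteriorPower.linearMap_ext (AlternatingMap.ext fun v => ?_)
    simp
  exact DFunLike.congr_fun this P

theorem eq_zero_of_pairingDual_eq_zero [FiniteDimensional ℝ V] {r : ℕ} {P : ⋀[ℝ]^r V}
    (h : ∀ ξ : Fin r → Module.Dual ℝ V,
      exteriorPower.pairingDual ℝ V r (exteriorPower.ιMulti ℝ r ξ) P = 0) : P = 0 := by
  let b := Module.finBasis ℝ V
  refine (b.exteriorPower r).ext_elem fun s => ?_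
  rw [exteriorPower.basis_repr_apply, map_zero, Finsupp.zero_apply]
  exact h _

/-- A multivector lies in `⋀^r` of the range of `A` as soon as it pairs to zero with all products
of covectors one of which vanishes on the range of `A`. -/
theorem mem_range_map_of_pairingDual_eq_zero [FiniteDimensional ℝ W] {r : ℕ} {A : V →ₗ[ℝ] W}
    (hA : Function.Injective A) {P : ⋀[ℝ]^r W}
    (h : ∀ ξ : Fin r → Module.Dual ℝ W, (∃ i, ξ i ∘ₗ A = 0) →
      exteriorPower.pairingDual ℝ W r (exteriorPower.ιMulti ℝ r ξ) P = 0) :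
    ∃ Q : ⋀[ℝ]^r V, exteriorPower.map r A Q = P := by
  obtain ⟨B, hB⟩ := A.exists_leftInverse_of_injective (LinearMap.ker_eq_bot.2 hA)
  refine ⟨exteriorPower.map r B P, ?_⟩
  rw [← sub_eq_zero]
  refine eq_zero_of_pairingDual_eq_zero fun ξ => ?_
  rw [map_sub, sub_eq_zero, pairingDual_map, pairingDual_map]
  let g : Module.Dual ℝ W [⋀^Fin r]→ₗ[ℝ] ℝ :=
    (LinearMap.applyₗ P).compAlternatingMap
      ((exteriorPower.pairingDual ℝ W r).compAlternatingMap (exteriorPower.ιMulti ℝ r))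
  have hg : ∀ ξ, g ξ =
    exteriorPower.pairingDual ℝ W r (exteriorPower.ιMulti ℝ r ξ) P := fun ξ => rfl
  rw [← hg, ← hg]
  -- Pushing `P` through the projection A ∘ B replaces each ξ i by η i, and ξ i - η i vanishes on
  -- the range of `A`. Expanding ξ = η + (ξ - η) multilinearly, every term except the pure η one
  -- contains such a factor and dies by `h`.
  set η : Fin r → Module.Dual ℝ W := fun i => (ξ i ∘ₗ A) ∘ₗ B
  have hη : ∀ i, (ξ i - η i) ∘ₗ A = 0 := fun i => by
    ext v
    have h1 : B (A v) = v := DFunLike.congr_fun hB v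
    simp [η, h1]
  have hsum : ξ = η + (ξ - η) := by simp
  rw [hsum]
  change g.toMultilinearMap η = g.toMultilinearMap (η + (ξ - η))
  rw [MultilinearMap.map_add_univ, Finset.sum_eq_single Finset.univ]
  · rw [Finset.piecewise_univ]
  · intro s _ hs
    obtain ⟨i, hi⟩ : ∃ i, i ∉ s := by
      by_contra! hall
      exact hs (Finset.eq_univ_iff_forall.2 hall)
    refine h _ ⟨i, ?_⟩
    rw [Finset.piecewise_eq_of_notMem _ _ _ hi]
    exact hη i
  · simp

section Contraction

open CliffordAlgebra ExteriorAlgebra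

/-- Contraction of a bivector with a covector. -/
theorem exists_contraction_bivector (ξ : Module.Dual ℝ V) (p : ⋀[ℝ]^2 V) :
    ∃ w : V, (∀ b : ExteriorAlgebra ℝ V,
        contractLeft (Q := (0 : QuadraticForm ℝ V)) ξ ((p : ExteriorAlgebra ℝ V) * b) =
          ExteriorAlgebra.ι ℝ w * b +
            (p : ExteriorAlgebra ℝ V) * contractLeft (Q := (0 : QuadraticForm ℝ V)) ξ b) ∧
      (∀ v, ExteriorAlgebra.ι ℝ v * (p : ExteriorAlgebra ℝ V) =
        (p : ExteriorAlgebra ℝ V) * ExteriorAlgebra.ι ℝ v) ∧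
      ∀ η : Module.Dual ℝ V, exteriorPower.pairingDual ℝ V 2
        (exteriorPower.ιMulti ℝ 2 ![ξ, η]) p = η w := by
  -- All three properties of the contraction `w` are linear in the pair (p, w), so decomposable
  -- bivectors suffice.
  have hp : p ∈ (⊤ : Submodule ℝ (⋀[ℝ]^2 V)) := trivial
  rw [← exteriorPower.ιMulti_span] at hp
  induction hp using Submodule.span_induction with
  | mem p hp =>
    obtain ⟨a, rfl⟩ := hp
    have hcoe : (exteriorPower.ιMulti ℝ 2 a : ExteriorAlgebra ℝ V) =
        ExteriorAlgebra.ι ℝ (a 0) * ExteriorAlgebra.ι ℝ (a 1) := by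
      rw [exteriorPower.ιMulti_apply_coe, ExteriorAlgebra.ιMulti_apply]
      simp [List.ofFn_succ]
    have hc : ∀ (d : Module.Dual ℝ V) (v : V) (b : ExteriorAlgebra ℝ V),
        contractLeft (Q := (0 : QuadraticForm ℝ V)) d (ExteriorAlgebra.ι ℝ v * b) =
          d v • b - ExteriorAlgebra.ι ℝ v * contractLeft (Q := (0 : QuadraticForm ℝ V)) d b :=
      fun d v b => contractLeft_ι_mul (Q := (0 : QuadraticForm ℝ V)) d v b
    have hanti : ∀ v w : V, ExteriorAlgebra.ι ℝ v * ExteriorAlgebra.ι ℝ w =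
        - (ExteriorAlgebra.ι ℝ w * ExteriorAlgebra.ι ℝ v) := fun v w =>
      eq_neg_of_add_eq_zero_left (ExteriorAlgebra.ι_add_mul_swap v w)
    -- This is the interior product of ξ with a₀ ∧ a₁.
    refine ⟨ξ (a 0) • a 1 - ξ (a 1) • a 0, fun b => ?_, fun v => ?_, fun η => ?_⟩
    · rw [hcoe, mul_assoc, hc, hc, map_sub, map_smul, map_smul, mul_sub, sub_mul, smul_mul_assoc,
        smul_mul_assoc, mul_smul_comm, ← mul_assoc (ExteriorAlgebra.ι ℝ (a 0))]
      abel
    · rw [hcoe, ← mul_assoc, hanti v (a 0), neg_mul, mul_assoc, hanti v (a 1), mul_neg, neg_neg,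
        mul_assoc]
    · rw [exteriorPower.pairingDual_ιMulti_ιMulti, Matrix.det_fin_two]
      simp
      ring
  | zero => exact ⟨0, by simp, by simp, by simp⟩
  | add p q _ _ hp hq =>
    obtain ⟨w, hw1, hw2, hw3⟩ := hp
    obtain ⟨z, hz1, hz2, hz3⟩ := hq
    refine ⟨w + z, fun b => ?_, fun v => ?_, fun η => ?_⟩
    · rw [Submodule.coe_add, add_mul, map_add, hw1, hz1, map_add, add_mul, add_mul]
      abel
    · rw [Submodule.coe_add, mul_add, add_mul, hw2, hz2]
    · rw [map_add, hw3, hz3, map_add]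
  | smul c p _ hp =>
    obtain ⟨w, hw1, hw2, hw3⟩ := hp
    refine ⟨c • w, fun b => ?_, fun v => ?_, fun η => ?_⟩
    · rw [Submodule.coe_smul, smul_mul_assoc, map_smul, hw1, map_smul, smul_mul_assoc,
        smul_mul_assoc, smul_add]
    · rw [Submodule.coe_smul, mul_smul_comm, smul_mul_assoc, hw2]
    · rw [map_smul, hw3, map_smul]

/-- If `p^{k+1} = 0`, then `p` pairs to zero with any covector vanishing on the annihilator of
`p^k`. -/
theorem pairingDual_eq_zero_of_wedgePow_succ_eq_zero {p : ⋀[ℝ]^2 V} {k : ℕ}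
    (hp : wedgePow p (k + 1) = 0) {ξ : Fin 2 → Module.Dual ℝ V} {i : Fin 2}
    (hξ : ∀ v, ExteriorAlgebra.ι ℝ v * (wedgePow p k : ExteriorAlgebra ℝ V) = 0 → ξ i v = 0) :
    exteriorPower.pairingDual ℝ V 2 (exteriorPower.ιMulti ℝ 2 ξ) p = 0 := by
  have hp0 : (p : ExteriorAlgebra ℝ V) ^ (k + 1) = 0 := congrArg Subtype.val hp
  have key : ∀ α β : Module.Dual ℝ V,
      (∀ v, ExteriorAlgebra.ι ℝ v * (wedgePow p k : ExteriorAlgebra ℝ V) = 0 → β v = 0) →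
      exteriorPower.pairingDual ℝ V 2 (exteriorPower.ιMulti ℝ 2 ![α, β]) p = 0 := by
    intro α β hβ
    obtain ⟨w, hw1, hw2, hw3⟩ := exists_contraction_bivector α p
    -- A bivector commutes with vectors, so contraction obeys the Leibniz power rule. At j = k the
    -- left side is zero and k + 1 is invertible, so w ∧ p^k = 0 and β kills `w`.
    have hpow : ∀ j : ℕ, contractLeft (Q := (0 : QuadraticForm ℝ V)) α
        ((p : ExteriorAlgebra ℝ V) ^ (j + 1)) =
        ((j + 1 : ℕ) : ℝ) • (ExteriorAlgebra.ι ℝ w * (p : ExteriorAlgebra ℝ V) ^ j) := by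
      intro j
      induction j with
      | zero =>
        have := hw1 1
        rw [contractLeft_one, mul_zero, add_zero] at this
        simpa using this
      | succ j ih =>
        rw [pow_succ', hw1, ih, mul_smul_comm, ← mul_assoc, ← hw2, mul_assoc, ← pow_succ']
        have hcast : ((j + 1 + 1 : ℕ) : ℝ) = 1 + ((j + 1 : ℕ) : ℝ) := by push_cast; ring
        rw [hcast, add_smul, one_smul]
    rw [hw3]
    refine hβ w ?_
    have h := hpow k
    rw [hp0, map_zero] at h
    exact (smul_eq_zero.1 h.symm).resolve_left (by positivity)
  fin_cases i
  · have h := key (ξ 1) (ξ 0) hξ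
    have hsw : exteriorPower.ιMulti ℝ 2 ![ξ 1, ξ 0] = -exteriorPower.ιMulti ℝ 2 ξ := by
      rw [← AlternatingMap.map_swap _ ξ (zero_ne_one : (0 : Fin 2) ≠ 1)]
      congr 1
      ext j : 1
      fin_cases j <;> simp
    rw [hsw, map_neg, LinearMap.neg_apply, neg_eq_zero] at h
    exact h
  · have h := key (ξ 0) (ξ 1) hξ
    have : ![ξ 0, ξ 1] = ξ := by
      ext j : 1
      fin_cases j <;> rfl
    rwa [this] at h

end Contraction

end Exterior

/-! ## Charts adapted to a submersion -/

section SubmersionCharts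

open Set Topology

/-- Charts of the source and the target of `pr` in which `pr` is a linear projection. -/
structure SubmersionChart (n q d : ℕ) {M : Type u} [TopologicalSpace M]
    [ChartedSpace (EuclideanSpace ℝ (Fin n)) M] {B : Type v} [TopologicalSpace B]
    [ChartedSpace (EuclideanSpace ℝ (Fin q)) B] (pr : M → B) where
  dom : OpenPartialHomeomorph M (EuclideanSpace ℝ (Fin n))
  cod : OpenPartialHomeomorph B (EuclideanSpace ℝ (Fin q))
  equiv : EuclideanSpace ℝ (Fin n) ≃L[ℝ] EuclideanSpace ℝ (Fin q) × EuclideanSpace ℝ (Fin d)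
  dom_mem : dom ∈ IsManifold.maximalAtlas (𝓡 n) ∞ M
  cod_mem : cod ∈ IsManifold.maximalAtlas (𝓡 q) ∞ B
  mapsTo : ∀ x ∈ dom.source, pr x ∈ cod.source
  apply_eq : ∀ x ∈ dom.source, cod (pr x) = (equiv (dom x)).1

variable {n q d : ℕ} {M : Type u} [TopologicalSpace M]
  [ChartedSpace (EuclideanSpace ℝ (Fin n)) M] {B : Type v} [TopologicalSpace B]
  [ChartedSpace (EuclideanSpace ℝ (Fin q)) B] {pr : M → B}

instance {m : ℕ} {N : Type*} [TopologicalSpace N] [ChartedSpace (EuclideanSpace ℝ (Fin m)) N]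
    (x : N) : FiniteDimensional ℝ (TangentSpace (𝓡 m) x) :=
  inferInstanceAs (FiniteDimensional ℝ (EuclideanSpace ℝ (Fin m)))

theorem finrank_tangentSpace {m : ℕ} {N : Type*} [TopologicalSpace N]
    [ChartedSpace (EuclideanSpace ℝ (Fin m)) N] (x : N) :
    Module.finrank ℝ (TangentSpace (𝓡 m) x) = m :=
  finrank_euclideanSpace_fin (𝕜 := ℝ)

theorem mdifferentiable_of_mem_maximalAtlas [IsManifold (𝓡 n) ∞ M]
    {φ : OpenPartialHomeomorph M (EuclideanSpace ℝ (Fin n))}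
    (hφ : φ ∈ IsManifold.maximalAtlas (𝓡 n) ∞ M) : φ.MDifferentiable (𝓡 n) (𝓡 n) :=
  ⟨(contMDiffOn_of_mem_maximalAtlas hφ).mdifferentiableOn (by simp),
    (contMDiffOn_symm_of_mem_maximalAtlas hφ).mdifferentiableOn (by simp)⟩

theorem ContinuousLinearMap.hasMFDerivAt_euclidean {F : Type*} [NormedAddCommGroup F]
    [NormedSpace ℝ F] (L : EuclideanSpace ℝ (Fin n) →L[ℝ] F) (x : EuclideanSpace ℝ (Fin n)) :
    HasMFDerivAt (𝓡 n) 𝓘(ℝ, F) L x L :=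
  L.hasFDerivAt.hasMFDerivAt

/-- The derivative of a linear function of the coordinates of a chart. -/
theorem hasMFDerivAt_comp_chart [IsManifold (𝓡 n) ∞ M]
    {φ : OpenPartialHomeomorph M (EuclideanSpace ℝ (Fin n))}
    (hφ : φ ∈ IsManifold.maximalAtlas (𝓡 n) ∞ M) {x : M} (hx : x ∈ φ.source)
    {F : Type*} [NormedAddCommGroup F] [NormedSpace ℝ F]
    (L : EuclideanSpace ℝ (Fin n) →L[ℝ] F) :
    HasMFDerivAt (𝓡 n) 𝓘(ℝ, F) (fun y => L (φ y)) x
      (L.comp (mfderiv (𝓡 n) (𝓡 n) φ x)) :=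
  (L.hasMFDerivAt_euclidean (φ x)).comp x
    ((mdifferentiable_of_mem_maximalAtlas hφ).mdifferentiableAt hx).hasMFDerivAt

/-- In the charts of the normal form, `j` is the injective linear map u ↦ (u, 0), and the chart
derivatives are injective. -/
theorem mfderiv_injective_of_isImmersionAt {m : ℕ} {P : Type*} [TopologicalSpace P]
    [ChartedSpace (EuclideanSpace ℝ (Fin m)) P] [IsManifold (𝓡 m) ∞ P] [IsManifold (𝓡 n) ∞ M]
    {j : P → M} {p : P} (hj : Manifold.IsImmersionAt (𝓡 m) (𝓡 n) ∞ j p) :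
    Function.Injective (mfderiv (𝓡 m) (𝓡 n) j p) := by
  have hφ := hj.domChart_mem_maximalAtlas
  have hψ := hj.codChart_mem_maximalAtlas
  have hp := hj.mem_domChart_source
  have hjp := hj.mem_codChart_source
  let L : EuclideanSpace ℝ (Fin m) →L[ℝ] EuclideanSpace ℝ (Fin n) :=
    (hj.equiv : EuclideanSpace ℝ (Fin m) × hj.complement →L[ℝ] _).comp (ContinuousLinearMap.inl ℝ _ _)
  have heq : ∀ y ∈ hj.domChart.source, hj.codChart (j y) = L (hj.domChart y) := by
    intro y hy
    have hmem : hj.domChart y ∈ (hj.domChart.extend (𝓡 m)).target := by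
      simpa using hj.domChart.map_source hy
    have := hj.writtenInCharts hmem
    simpa [L, hj.domChart.left_inv hy] using this
  have h1 := hasMFDerivAt_comp_chart hφ hp L
  have hjd := (hj.contMDiffAt.mdifferentiableAt (by simp)).hasMFDerivAt
  have h2 := ((mdifferentiable_of_mem_maximalAtlas hψ).mdifferentiableAt
    hjp).hasMFDerivAt.comp p hjd
  have h3 := h1.congr_of_eventuallyEq
    (Filter.eventuallyEq_of_mem (hj.domChart.open_source.mem_nhds hp) heq)
  have h4 := hasMFDerivAt_unique h2 h3
  have hinj : Function.Injective (L.comp (mfderiv (𝓡 m) (𝓡 m) hj.domChart p)) := by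
    refine (hj.equiv.injective.comp (Prod.mk_left_injective 0)).comp ?_
    exact (mdifferentiable_of_mem_maximalAtlas hφ).mfderiv_injective hp
  intro a b hab
  refine hinj ?_
  have ha := DFunLike.congr_fun h4 a
  have hb := DFunLike.congr_fun h4 b
  refine ha.symm.trans (Eq.trans ?_ hb)
  exact congrArg (mfderiv (𝓡 n) (𝓡 n) hj.codChart (j p)) hab

namespace SubmersionChart

theorem mem_ker_mfderiv_iff [IsManifold (𝓡 n) ∞ M] [IsManifold (𝓡 q) ∞ B]
    (s : SubmersionChart n q d pr) (hpr : ContMDiff (𝓡 n) (𝓡 q) ∞ pr) {x : M}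
    (hx : x ∈ s.dom.source) (v : TangentSpace (𝓡 n) x) :
    mfderiv (𝓡 n) (𝓡 q) pr x v = 0 ↔
      (s.equiv (mfderiv (𝓡 n) (𝓡 n) s.dom x v)).1 = 0 := by
  let L : EuclideanSpace ℝ (Fin n) →L[ℝ] EuclideanSpace ℝ (Fin q) :=
    (ContinuousLinearMap.fst ℝ _ _).comp
      s.equiv.toContinuousLinearMap
  have h1 := hasMFDerivAt_comp_chart s.dom_mem hx L
  have h2 := ((mdifferentiable_of_mem_maximalAtlas s.cod_mem).mdifferentiableAt
    (s.mapsTo x hx)).hasMFDerivAt.comp x (hpr.mdifferentiable (by simp) x).hasMFDerivAt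
  have h3 := h1.congr_of_eventuallyEq
    (Filter.eventuallyEq_of_mem (s.dom.open_source.mem_nhds hx) s.apply_eq)
  have h4 := DFunLike.congr_fun (hasMFDerivAt_unique h2 h3) v
  have hinj := (mdifferentiable_of_mem_maximalAtlas s.cod_mem).mfderiv_injective (s.mapsTo x hx)
  have h5 : mfderiv (𝓡 q) (𝓡 q) s.cod (pr x) (mfderiv (𝓡 n) (𝓡 q) pr x v) =
      (s.equiv (mfderiv (𝓡 n) (𝓡 n) s.dom x v)).1 := h4
  rw [← h5]
  exact (map_eq_zero_iff _ hinj).symm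

theorem finrank_ker_mfderiv [IsManifold (𝓡 n) ∞ M] [IsManifold (𝓡 q) ∞ B]
    (s : SubmersionChart n q d pr) (hpr : ContMDiff (𝓡 n) (𝓡 q) ∞ pr) {x : M}
    (hx : x ∈ s.dom.source) :
    Module.finrank ℝ (mfderiv (𝓡 n) (𝓡 q) pr x).toLinearMap.ker = d := by
  let A : TangentSpace (𝓡 n) x ≃ₗ[ℝ] EuclideanSpace ℝ (Fin q) × EuclideanSpace ℝ (Fin d) :=
    (LinearEquiv.ofBijective (mfderiv (𝓡 n) (𝓡 n) s.dom x).toLinearMap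
      ((mdifferentiable_of_mem_maximalAtlas s.dom_mem).mfderiv_bijective hx)).trans
      (s.equiv.toLinearEquiv : EuclideanSpace ℝ (Fin n) ≃ₗ[ℝ] _)
  have hker : (mfderiv (𝓡 n) (𝓡 q) pr x).toLinearMap.ker =
      (LinearMap.fst ℝ _ _ ∘ₗ A.toLinearMap).ker := by
    ext v
    exact s.mem_ker_mfderiv_iff hpr hx v
  have hsurj : Function.Surjective (LinearMap.fst ℝ _ _ ∘ₗ A.toLinearMap) :=
    (LinearMap.fst_surjective (R := ℝ)).comp A.surjective
  have h1 := (LinearMap.fst ℝ _ _ ∘ₗ A.toLinearMap).finrank_range_add_finrank_ker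
  rw [LinearMap.range_eq_top.2 hsurj, finrank_top, A.finrank_eq, Module.finrank_prod,
    finrank_euclideanSpace_fin, finrank_euclideanSpace_fin] at h1
  rw [hker]
  omega

/-- A fibre that is a smooth image of an `e`-dimensional manifold has dimension at most `e`. -/
theorem dim_le_of_fiber_eq_range [IsManifold (𝓡 n) ∞ M] (s : SubmersionChart n q d pr) {x : M}
    (hx : x ∈ s.dom.source) {e : ℕ} {P : Type*} [TopologicalSpace P] [SecondCountableTopology P]
    [ChartedSpace (EuclideanSpace ℝ (Fin e)) P] [IsManifold (𝓡 e) ∞ P] {j : P → M}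
    (hj : ContMDiff (𝓡 e) (𝓡 n) ∞ j) (hrange : range j = pr ⁻¹' {pr x}) : d ≤ e := by
  let L : EuclideanSpace ℝ (Fin n) →L[ℝ] EuclideanSpace ℝ (Fin d) :=
    (ContinuousLinearMap.snd ℝ _ _).comp
      s.equiv.toContinuousLinearMap
  let S : Set P := j ⁻¹' s.dom.source
  have hS : IsOpen S := s.dom.open_source.preimage hj.continuous
  let g : P → EuclideanSpace ℝ (Fin d) := fun p => L (s.dom (j p))
  have hg : ContMDiffOn (𝓡 e) (𝓡 d) ∞ g S :=
    (L.contDiff.contMDiff.comp_contMDiffOn (contMDiffOn_of_mem_maximalAtlas s.dom_mem)).comp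
      hj.contMDiffOn fun p hp => hp
  let Y : Set (EuclideanSpace ℝ (Fin d)) :=
    (fun y => s.equiv.symm (s.cod (pr x), y)) ⁻¹' s.dom.target
  have hY : IsOpen Y := s.dom.open_target.preimage (by fun_prop)
  have hxY : L (s.dom x) ∈ Y := by
    change s.equiv.symm (s.cod (pr x), (s.equiv (s.dom x)).2) ∈ s.dom.target
    rw [s.apply_eq x hx, Prod.mk.eta, ContinuousLinearEquiv.symm_apply_apply]
    exact s.dom.map_source hx
  -- In an adapted chart the fibre contains an open piece of ℝ^d, and all of it is reached by `j`.
  have hYg : Y ⊆ g '' S := by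
    intro y hy
    set m := s.dom.symm (s.equiv.symm (s.cod (pr x), y))
    have hm : m ∈ s.dom.source := s.dom.map_target hy
    have hdm : s.dom m = s.equiv.symm (s.cod (pr x), y) := s.dom.right_inv hy
    have hprm : pr m = pr x := by
      refine s.cod.injOn (s.mapsTo m hm) (s.mapsTo x hx) ?_
      rw [s.apply_eq m hm, hdm, ContinuousLinearEquiv.apply_symm_apply]
    obtain ⟨p, hp⟩ : m ∈ range j := by rw [hrange]; exact hprm
    refine ⟨p, by change j p ∈ s.dom.source; rwa [hp], ?_⟩
    change (s.equiv (s.dom (j p))).2 = y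
    rw [hp, hdm, ContinuousLinearEquiv.apply_symm_apply]
  -- Smooth maps do not raise Hausdorff dimension and countably many charts cover `P`, so the open
  -- set `Y` of dimension `d` has dimension at most `e`.
  have hloc : ∀ p : P, dimH (g '' (S ∩ (chartAt (EuclideanSpace ℝ (Fin e)) p).source)) ≤ e := by
    intro p
    set χ := chartAt (EuclideanSpace ℝ (Fin e)) p
    have hχ : χ ∈ IsManifold.maximalAtlas (𝓡 e) ∞ P := IsManifold.chart_mem_maximalAtlas p
    have him : g '' (S ∩ χ.source) ⊆ (g ∘ χ.symm) '' (χ.target ∩ χ.symm ⁻¹' S) := by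
      rintro _ ⟨p', ⟨hp', hpχ⟩, rfl⟩
      refine ⟨χ p', ⟨χ.map_source hpχ, ?_⟩, ?_⟩
      · rwa [mem_preimage, χ.left_inv hpχ]
      · rw [Function.comp_apply, χ.left_inv hpχ]
    have hsm : ContDiffOn ℝ ∞ (g ∘ χ.symm) (χ.target ∩ χ.symm ⁻¹' S) := by
      rw [← contMDiffOn_iff_contDiffOn]
      exact hg.comp ((contMDiffOn_symm_of_mem_maximalAtlas hχ).mono inter_subset_left)
        fun z hz => hz.2
    have hop : IsOpen (χ.target ∩ χ.symm ⁻¹' S) := χ.isOpen_inter_preimage_symm hS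
    refine (dimH_mono him).trans ?_
    calc dimH ((g ∘ χ.symm) '' (χ.target ∩ χ.symm ⁻¹' S))
        ≤ dimH (χ.target ∩ χ.symm ⁻¹' S) := by
          refine dimH_image_le_of_locally_lipschitzOn fun z hz => ?_
          obtain ⟨C, t, ht, hC⟩ :=
            ((hsm.contDiffAt (hop.mem_nhds hz)).of_le (m := 1) (by simp)).exists_lipschitzOnWith
          exact ⟨C, t, mem_nhdsWithin_of_mem_nhds ht, hC⟩
      _ ≤ dimH (univ : Set (EuclideanSpace ℝ (Fin e))) := dimH_mono (subset_univ _)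
      _ = e := by rw [Real.dimH_univ_eq_finrank, finrank_euclideanSpace_fin]
  obtain ⟨t, htc, htU⟩ := TopologicalSpace.countable_cover_nhds
    (fun p : P => chart_source_mem_nhds (EuclideanSpace ℝ (Fin e)) p)
  have hcov : g '' S ⊆ ⋃ p ∈ t, g '' (S ∩ (chartAt (EuclideanSpace ℝ (Fin e)) p).source) := by
    rintro _ ⟨p, hp, rfl⟩
    have : p ∈ ⋃ x ∈ t, (chartAt (EuclideanSpace ℝ (Fin e)) x).source := htU ▸ mem_univ p
    obtain ⟨y, hy, hpy⟩ := mem_iUnion₂.1 this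
    exact mem_iUnion₂.2 ⟨y, hy, p, ⟨hp, hpy⟩, rfl⟩
  have h1 : dimH Y ≤ e := by
    refine (dimH_mono (hYg.trans hcov)).trans ?_
    rw [dimH_bUnion htc]
    exact iSup₂_le fun p _ => hloc p
  rw [Real.dimH_of_mem_nhds (hY.mem_nhds hxY), finrank_euclideanSpace_fin] at h1
  exact_mod_cast h1

end SubmersionChart

/-- Every point in the source of a submersion has an adapted chart. -/
theorem exists_submersionChart (hpr : Manifold.IsSubmersion (𝓡 n) (𝓡 q) ∞ pr) (x : M) :
    ∃ d, ∃ s : SubmersionChart n q d pr, x ∈ s.dom.source := by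
  have h := hpr.isSubmersionAt x
  have : FiniteDimensional ℝ h.complement :=
    FiniteDimensional.of_surjective
      (LinearMap.snd ℝ (EuclideanSpace ℝ (Fin q)) h.complement ∘ₗ
        (h.equiv.toLinearEquiv : EuclideanSpace ℝ (Fin n) →ₗ[ℝ] _))
      ((LinearMap.snd_surjective (R := ℝ)).comp h.equiv.surjective)
  let ε : h.complement ≃L[ℝ] EuclideanSpace ℝ (Fin (Module.finrank ℝ h.complement)) :=
    ContinuousLinearEquiv.ofFinrankEq (by rw [finrank_euclideanSpace_fin])
  refine ⟨_, ⟨h.domChart, h.codChart,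
    h.equiv.trans ((ContinuousLinearEquiv.refl ℝ _).prodCongr ε), h.domChart_mem_maximalAtlas,
    h.codChart_mem_maximalAtlas, h.source_subset_preimage_source, fun y hy => ?_⟩,
    h.mem_domChart_source⟩
  have hmem : h.domChart y ∈ (h.domChart.extend (𝓡 n)).target := by
    simpa using h.domChart.map_source hy
  have := h.writtenInCharts hmem
  simpa [h.domChart.left_inv hy] using this

variable [IsManifold (𝓡 n) ∞ M] [IsManifold (𝓡 q) ∞ B]

/-- Since `pr` is constant on the immersed leaf, `D` lies in the kernel of its differential, so e ≤
d for the kernel dimension d. The Hausdorff dimension bound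
`SubmersionChart.dim_le_of_fiber_eq_range` gives d ≤ e, so the two subspaces agree. -/
theorem IsLeafSpace.exists_chart_and_eq_ker {e : ℕ}
    {D : ∀ x : M, Submodule ℝ (TangentSpace (𝓡 n) x)} (hpr : IsLeafSpace (q := q) e D pr) (x : M) :
    (∃ s : SubmersionChart n q e pr, x ∈ s.dom.source) ∧
      D x = (mfderiv (𝓡 n) (𝓡 q) pr x).toLinearMap.ker := by
  obtain ⟨d, s, hx⟩ := exists_submersionChart hpr.submersion x
  have hleaf : IsLeaf e D (pr ⁻¹' {pr x}) := (hpr.leaf_iff _).2 ⟨pr x, rfl⟩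
  obtain ⟨P, _, _, _, _, _, _, j, hj, -, hrange, htan⟩ := hleaf.prop
  obtain ⟨p, hp⟩ : x ∈ range j := by rw [hrange]; rfl
  have hsm := hpr.submersion.contMDiff
  have hde := s.dim_le_of_fiber_eq_range hx hj.contMDiff hrange
  have hD := htan p
  rw [hp] at hD
  have hle : D x ≤ (mfderiv (𝓡 n) (𝓡 q) pr x).toLinearMap.ker := by
    subst hp
    rw [← hD]
    rintro _ ⟨v, rfl⟩
    have h1 := (hsm.mdifferentiable (by simp) (j p)).hasMFDerivAt.comp p
      (hj.contMDiff.mdifferentiable (by simp) p).hasMFDerivAt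
    have h2 : HasMFDerivAt (𝓡 e) (𝓡 q) (pr ∘ j) p 0 := by
      have : pr ∘ j = fun _ => pr (j p) := by
        ext p'
        have : j p' ∈ pr ⁻¹' {pr (j p)} := by rw [← hrange]; exact mem_range_self p'
        exact this
      rw [this]
      exact hasMFDerivAt_const _ _
    exact DFunLike.congr_fun (hasMFDerivAt_unique h1 h2) v
  have hfin : Module.finrank ℝ (D x) = e := by
    subst hp
    rw [← hD, LinearMap.finrank_range_of_inj
      (mfderiv_injective_of_isImmersionAt (hj.isImmersionAt p)), finrank_tangentSpace]
  have hker := s.finrank_ker_mfderiv hsm hx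
  have hed : e ≤ d := by
    rw [← hfin, ← hker]
    exact Submodule.finrank_mono hle
  obtain rfl : d = e := le_antisymm hde hed
  exact ⟨⟨s, hx⟩, Submodule.eq_of_le_of_finrank_eq hle (by rw [hfin, hker])⟩

end SubmersionCharts

/-! ## Fibres of a submersion -/

section Fiber

open Set Topology

variable {n q d : ℕ} {M : Type u} [TopologicalSpace M]
  [ChartedSpace (EuclideanSpace ℝ (Fin n)) M] {B : Type v} [TopologicalSpace B]
  [ChartedSpace (EuclideanSpace ℝ (Fin q)) B] {pr : M → B}

noncomputable section

namespace SubmersionChart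

variable (s : SubmersionChart n q d pr) (c : B)

/-- The slice `{pr = c}` in the coordinates of an adapted chart. -/
def slice (y : EuclideanSpace ℝ (Fin d)) : EuclideanSpace ℝ (Fin n) :=
  s.equiv.symm (s.cod c, y)

theorem contDiff_slice : ContDiff ℝ ∞ (s.slice c) := by
  unfold slice; fun_prop

/-- The projection to the fibre coordinates of an adapted chart. -/
def proj : EuclideanSpace ℝ (Fin n) →L[ℝ] EuclideanSpace ℝ (Fin d) :=
  (ContinuousLinearMap.snd ℝ _ _).comp s.equiv.toContinuousLinearMap

@[simp]
theorem proj_slice (y : EuclideanSpace ℝ (Fin d)) : s.proj (s.slice c y) = y := by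
  simp [proj, slice]

theorem slice_proj_dom {x : M} (hx : x ∈ s.dom.source) (hc : pr x = c) :
    s.slice c (s.proj (s.dom x)) = s.dom x := by
  subst hc
  change s.equiv.symm (s.cod (pr x), (s.equiv (s.dom x)).2) = s.dom x
  rw [s.apply_eq x hx, Prod.mk.eta, ContinuousLinearEquiv.symm_apply_apply]

theorem pr_symm_slice (hc : c ∈ s.cod.source) {y : EuclideanSpace ℝ (Fin d)}
    (hy : s.slice c y ∈ s.dom.target) : pr (s.dom.symm (s.slice c y)) = c := by
  have hm := s.dom.map_target hy
  refine s.cod.injOn (s.mapsTo _ hm) hc ?_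
  rw [s.apply_eq _ hm, s.dom.right_inv hy, slice, ContinuousLinearEquiv.apply_symm_apply]

open Classical in
/-- The chart of the fibre over `c` induced by an adapted chart around a point `p` of the fibre. -/
def fiberChart (p : pr ⁻¹' {c}) (hp : (p : M) ∈ s.dom.source) :
    OpenPartialHomeomorph (pr ⁻¹' {c}) (EuclideanSpace ℝ (Fin d)) where
  toFun z := s.proj (s.dom z)
  -- The value `p` off the target only makes the inverse total. That `p` lies in the chart domain
  -- also shows that `c` is in the codomain chart, which is what puts the slice inside the fibre.
  invFun y := if h : s.slice c y ∈ s.dom.target then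
    ⟨s.dom.symm (s.slice c y), s.pr_symm_slice c (by
      have h1 := s.mapsTo _ hp
      rwa [show pr p = c from p.2] at h1) h⟩ else p
  source := {z | (z : M) ∈ s.dom.source}
  target := {y | s.slice c y ∈ s.dom.target}
  map_source' z hz := by
    change s.slice c (s.proj (s.dom z)) ∈ s.dom.target
    rw [s.slice_proj_dom c hz z.2]
    exact s.dom.map_source hz
  map_target' y hy := by
    simp only [mem_ofPred_eq] at hy
    simp only [mem_ofPred_eq, dif_pos hy]
    exact s.dom.map_target hy
  left_inv' z hz := by
    have h1 := s.slice_proj_dom c hz z.2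
    have h2 : s.slice c (s.proj (s.dom z)) ∈ s.dom.target := by
      rw [h1]; exact s.dom.map_source hz
    simp only [dif_pos h2]
    refine Subtype.ext ?_
    change s.dom.symm (s.slice c (s.proj (s.dom z))) = z
    rw [h1, s.dom.left_inv hz]
  right_inv' y hy := by
    simp only [mem_ofPred_eq] at hy
    simp only [dif_pos hy]
    rw [s.dom.right_inv hy, proj_slice]
  open_source := s.dom.open_source.preimage continuous_subtype_val
  open_target := s.dom.open_target.preimage (s.contDiff_slice c).continuous
  continuousOn_toFun := s.proj.continuous.comp_continuousOn
    (s.dom.continuousOn.comp continuous_subtype_val.continuousOn fun _ hz => hz)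
  continuousOn_invFun := by
    rw [IsInducing.subtypeVal.continuousOn_iff]
    refine ContinuousOn.congr (f := fun y => s.dom.symm (s.slice c y)) ?_ ?_
    · exact s.dom.symm.continuousOn.comp (s.contDiff_slice c).continuous.continuousOn
        fun _ hy => hy
    · intro y hy
      simp only [mem_ofPred_eq] at hy
      simp only [Function.comp_apply, dif_pos hy]

open Classical in
theorem coe_fiberChart_symm (p : pr ⁻¹' {c}) (hp : (p : M) ∈ s.dom.source)
    {y : EuclideanSpace ℝ (Fin d)} (hy : y ∈ (s.fiberChart c p hp).target) :
    ((s.fiberChart c p hp).symm y : M) = s.dom.symm (s.slice c y) := by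
  have hy' : s.slice c y ∈ s.dom.target := hy
  have : (s.fiberChart c p hp).symm y = if h : s.slice c y ∈ s.dom.target then
    ⟨s.dom.symm (s.slice c y), s.pr_symm_slice c (by
      have h1 := s.mapsTo _ hp
      rwa [show pr p = c from p.2] at h1) h⟩ else p := rfl
  rw [this, dif_pos hy']

end SubmersionChart

variable (h : ∀ x : M, ∃ s : SubmersionChart n q d pr, x ∈ s.dom.source) (c : B)

/-- The charts of a fibre. -/
def fiberChartAt (p : pr ⁻¹' {c}) :
    OpenPartialHomeomorph (pr ⁻¹' {c}) (EuclideanSpace ℝ (Fin d)) :=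
  (h p).choose.fiberChart c p (h p).choose_spec

/-- The manifold structure on a fibre of a submersion. -/
@[reducible]
def fiberChartedSpace : ChartedSpace (EuclideanSpace ℝ (Fin d)) (pr ⁻¹' {c}) where
  atlas := range (fiberChartAt h c)
  chartAt := fiberChartAt h c
  mem_chart_source p := (h p).choose_spec
  chart_mem_atlas p := ⟨p, rfl⟩

theorem isManifold_fiber [IsManifold (𝓡 n) ∞ M] :
    letI := fiberChartedSpace h c
    IsManifold (𝓡 d) ∞ (pr ⁻¹' {c}) := by
  let := fiberChartedSpace h c
  refine isManifold_of_contDiffOn _ _ _ ?_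
  rintro _ _ ⟨p, rfl⟩ ⟨p', rfl⟩
  set s := (h p).choose with hs
  set s' := (h p').choose with hs'
  have hsm : ContMDiffOn (𝓡 d) (𝓡 d) ∞
      (fun y => s'.proj (s'.dom (s.dom.symm (s.slice c y))))
      (((fiberChartAt h c p).symm.trans (fiberChartAt h c p')).source) := by
    refine s'.proj.contDiff.contMDiff.comp_contMDiffOn
      ((contMDiffOn_of_mem_maximalAtlas s'.dom_mem).comp
        ((contMDiffOn_symm_of_mem_maximalAtlas s.dom_mem).comp
          (s.contDiff_slice c).contMDiff.contMDiffOn ?_) ?_)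
    · exact fun y hy => hy.1
    · intro y hy
      have := s.coe_fiberChart_symm c p (h p).choose_spec hy.1
      have h2 : (((fiberChartAt h c p).symm y : pr ⁻¹' {c}) : M) ∈ s'.dom.source := hy.2
      change s.dom.symm (s.slice c y) ∈ s'.dom.source
      rw [← this]
      exact h2
  rw [contMDiffOn_iff_contDiffOn] at hsm
  have hset : (𝓡 d).symm ⁻¹' ((fiberChartAt h c p).symm.trans (fiberChartAt h c p')).source ∩
      range (𝓡 d) = ((fiberChartAt h c p).symm.trans (fiberChartAt h c p')).source := by
    simp
  rw [hset]
  refine hsm.congr fun y hy => ?_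
  have := s.coe_fiberChart_symm c p (h p).choose_spec hy.1
  rw [← this]
  rfl

theorem isSmoothEmbedding_fiber [IsManifold (𝓡 n) ∞ M] :
    letI := fiberChartedSpace h c
    Manifold.IsSmoothEmbedding (𝓡 d) (𝓡 n) ∞ (Subtype.val : pr ⁻¹' {c} → M) := by
  let := fiberChartedSpace h c
  have := isManifold_fiber h c
  refine ⟨Manifold.IsImmersionOfComplement.isImmersion (F := EuclideanSpace ℝ (Fin q))
    fun p => ?_, IsEmbedding.subtypeVal⟩
  set s := (h p).choose with hs
  have hp : (p : M) ∈ s.dom.source := (h p).choose_spec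
  -- The slice is an affine subspace, while the immersion normal form u ↦ (u, 0) is linear; a
  -- translation of the chart reconciles them.
  let T : EuclideanSpace ℝ (Fin n) ≃ₜ EuclideanSpace ℝ (Fin n) :=
    Homeomorph.addRight (-s.slice c 0)
  have hT : ContDiff ℝ ∞ T := contDiff_id.add contDiff_const
  have hT' : ContDiff ℝ ∞ T.symm := by
    have : ⇑T.symm = fun x => x + s.slice c 0 := by
      ext x : 1
      rw [Homeomorph.symm_apply_eq]
      simp [T]
    rw [this]
    fun_prop
  have hmem : s.dom.transHomeomorph T ∈ IsManifold.maximalAtlas (𝓡 n) ∞ M := by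
    rw [IsManifold.mem_maximalAtlas_iff_contMDiffOn]
    exact ⟨hT.contMDiff.comp_contMDiffOn (contMDiffOn_of_mem_maximalAtlas s.dom_mem),
      (contMDiffOn_symm_of_mem_maximalAtlas s.dom_mem).comp hT'.contMDiff.contMDiffOn
        fun _ hx => hx⟩
  refine Manifold.IsImmersionAtOfComplement.mk_of_continuousAt
    continuous_subtype_val.continuousAt
    ((ContinuousLinearEquiv.prodComm ℝ _ _).trans s.equiv.symm)
    (fiberChartAt h c p) (s.dom.transHomeomorph T) hp hp
    (IsManifold.chart_mem_maximalAtlas p) hmem ?_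
  intro y hy
  have hy' : y ∈ (s.fiberChart c p hp).target := by
    have : y ∈ (fiberChartAt h c p).target := by simpa using hy
    exact this
  have h1 := s.coe_fiberChart_symm c p hp hy'
  have h2 : s.slice c y - s.slice c 0 = s.equiv.symm (0, y) := by
    rw [SubmersionChart.slice, SubmersionChart.slice, ← map_sub]
    simp
  have h3 : s.dom.transHomeomorph T ((fiberChartAt h c p).symm y : pr ⁻¹' {c}) =
      s.equiv.symm (0, y) := by
    change s.dom ((s.fiberChart c p hp).symm y : pr ⁻¹' {c}) + -s.slice c 0 = _
    rw [h1, s.dom.right_inv hy', ← sub_eq_add_neg, h2]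
  simpa using h3

/-- The range lies in the kernel because `pr` is constant on the fibre, and both have dimension `d`.
-/
theorem hasTangent_fiber [IsManifold (𝓡 n) ∞ M] [IsManifold (𝓡 q) ∞ B]
    (hpr : ContMDiff (𝓡 n) (𝓡 q) ∞ pr) :
    letI := fiberChartedSpace h c
    HasTangent (d := d) (fun x => (mfderiv (𝓡 n) (𝓡 q) pr x).toLinearMap.ker)
      (Subtype.val : pr ⁻¹' {c} → M) := by
  let := fiberChartedSpace h c
  have := isManifold_fiber h c
  have hemb := isSmoothEmbedding_fiber h c
  intro p
  obtain ⟨s, hs⟩ := h p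
  refine Submodule.eq_of_le_of_finrank_eq ?_ ?_
  · rintro _ ⟨v, rfl⟩
    have h1 := (hpr.mdifferentiable (by simp) (p : M)).hasMFDerivAt.comp p
      (hemb.contMDiff.mdifferentiable (by simp) p).hasMFDerivAt
    have h2 : HasMFDerivAt (𝓡 d) (𝓡 q) (pr ∘ Subtype.val) p 0 := by
      have : pr ∘ (Subtype.val : pr ⁻¹' {c} → M) = fun _ => c := funext fun z => z.2
      rw [this]
      exact hasMFDerivAt_const _ _
    exact DFunLike.congr_fun (hasMFDerivAt_unique h1 h2) v
  · rw [s.finrank_ker_mfderiv hpr hs, LinearMap.finrank_range_of_inj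
      (mfderiv_injective_of_isImmersionAt (hemb.isImmersion.isImmersionAt p)),
      finrank_tangentSpace]

/-- Smooth functions on a fibre extend locally to the ambient manifold. -/
theorem exists_local_extension_fiber [IsManifold (𝓡 n) ∞ M] {ι : Type*}
    {V : Set (pr ⁻¹' {c})} (hV : IsOpen V) (p : pr ⁻¹' {c}) (hp : p ∈ V)
    (f : ι → pr ⁻¹' {c} → ℝ)
    (hf : letI := fiberChartedSpace h c
      ∀ i, ContMDiffOn (𝓡 d) 𝓘(ℝ, ℝ) ∞ (f i) V) :
    ∃ (O : Set M) (F : ι → M → ℝ), IsOpen O ∧ (p : M) ∈ O ∧ Subtype.val ⁻¹' O ⊆ V ∧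
      (∀ i, ContMDiffOn (𝓡 n) 𝓘(ℝ, ℝ) ∞ (F i) O) ∧
      ∀ i, ∀ z : pr ⁻¹' {c}, (z : M) ∈ O → F i z = f i z := by
  let := fiberChartedSpace h c
  have := isManifold_fiber h c
  set s := (h p).choose with hs
  have hps : (p : M) ∈ s.dom.source := (h p).choose_spec
  set χ := fiberChartAt h c p with hχdef
  have hχ : χ ∈ IsManifold.maximalAtlas (𝓡 d) ∞ (pr ⁻¹' {c}) :=
    IsManifold.chart_mem_maximalAtlas p
  let T : Set (EuclideanSpace ℝ (Fin d)) := χ.target ∩ χ.symm ⁻¹' V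
  have hT : IsOpen T := χ.isOpen_inter_preimage_symm hV
  let g : M → EuclideanSpace ℝ (Fin d) := fun x => s.proj (s.dom x)
  have hg : ContMDiffOn (𝓡 n) (𝓡 d) ∞ g s.dom.source :=
    s.proj.contDiff.contMDiff.comp_contMDiffOn (contMDiffOn_of_mem_maximalAtlas s.dom_mem)
  have hχg : ∀ z : pr ⁻¹' {c}, χ z = g z := fun z => rfl
  have hmem : ∀ z : pr ⁻¹' {c}, (z : M) ∈ s.dom.source → (z ∈ V ↔ g z ∈ T) := by
    intro z hz
    have hz' : z ∈ χ.source := hz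
    rw [← hχg]
    constructor
    · exact fun hzV => ⟨χ.map_source hz', by rwa [mem_preimage, χ.left_inv hz']⟩
    · rintro ⟨-, hzV⟩
      rwa [mem_preimage, χ.left_inv hz'] at hzV
  -- The extension is constant along the base coordinates: it is pulled back by the local retraction
  -- of `M` onto the fibre.
  refine ⟨s.dom.source ∩ g ⁻¹' T, fun i x => f i (χ.symm (g x)),
    hg.continuousOn.isOpen_inter_preimage s.dom.open_source hT, ⟨hps, (hmem p hps).1 hp⟩,
    fun z hz => (hmem z hz.1).2 hz.2, fun i => ?_, fun i z hz => ?_⟩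
  · exact ((hf i).comp ((contMDiffOn_symm_of_mem_maximalAtlas hχ).mono inter_subset_left)
      (t := V) (fun y (hy : y ∈ T) => hy.2)).comp (hg.mono inter_subset_left) fun x hx => hx.2
  · have hz' : z ∈ χ.source := hz.1
    change f i (χ.symm (g z)) = f i z
    rw [← hχg, χ.left_inv hz']

end

end Fiber

/-! ## Coefficients of multivector fields -/

section Coefficients

open Set Topology

variable {n : ℕ} {M : Type u} [TopologicalSpace M] [ChartedSpace (EuclideanSpace ℝ (Fin n)) M]

theorem covector_congr {f g : M → ℝ} {x : M} (h : f =ᶠ[𝓝 x] g) :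
    covector (n := n) f x = covector g x := by
  unfold covector
  rw [h.mfderiv_eq]

theorem covector_comp {d : ℕ} {P : Type*} [TopologicalSpace P]
    [ChartedSpace (EuclideanSpace ℝ (Fin d)) P] {j : P → M} {p : P} {F : M → ℝ}
    (hF : MDifferentiableAt (𝓡 n) 𝓘(ℝ, ℝ) F (j p)) (hj : MDifferentiableAt (𝓡 d) (𝓡 n) j p) :
    covector (n := d) (fun y => F (j y)) p =
      covector (n := n) F (j p) ∘ₗ (mfderiv (𝓡 d) (𝓡 n) j p).toLinearMap := by
  have := (hF.hasMFDerivAt.comp p hj.hasMFDerivAt).mfderiv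
  exact congrArg ContinuousLinearMap.toLinearMap this

/-- The value on functions of a multivector field along a map. -/
theorem MultivectorField.eval_eq_of_map_eq {d r : ℕ} {P : Type*} [TopologicalSpace P]
    [ChartedSpace (EuclideanSpace ℝ (Fin d)) P] {j : P → M} {p : P}
    (hj : MDifferentiableAt (𝓡 d) (𝓡 n) j p) {Q : MultivectorField d P r}
    {R : MultivectorField n M r}
    (hQR : exteriorPower.map r (mfderiv (𝓡 d) (𝓡 n) j p).toLinearMap (Q p) = R (j p))
    {f : Fin r → P → ℝ} {F : Fin r → M → ℝ}
    (hF : ∀ i, MDifferentiableAt (𝓡 n) 𝓘(ℝ, ℝ) (F i) (j p))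
    (hfF : ∀ i, f i =ᶠ[𝓝 p] fun y => F i (j y)) :
    Q.eval f p = R.eval F (j p) := by
  unfold MultivectorField.eval
  rw [← hQR, pairingDual_map]
  congr 3
  ext i : 1
  rw [covector_congr (hfF i), covector_comp (hF i) hj]

/-- Turns transversality into df ≠ 0: the sum is everything exactly when the graph contains a vector
with nonzero vertical component. -/
theorem graph_sup_eq_top_iff {V : Type*} [AddCommGroup V] [Module ℝ V] (ξ : Module.Dual ℝ V) :
    LinearMap.graph ξ ⊔ Submodule.prod (⊤ : Submodule ℝ V) (⊥ : Submodule ℝ ℝ) = ⊤ ↔ ξ ≠ 0 := by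
  constructor
  · rintro h rfl
    have hle : LinearMap.graph (0 : V →ₗ[ℝ] ℝ) ⊔ Submodule.prod (⊤ : Submodule ℝ V) ⊥ ≤
        Submodule.prod (⊤ : Submodule ℝ V) (⊥ : Submodule ℝ ℝ) := by
      refine sup_le (fun x hx => ?_) le_rfl
      rw [LinearMap.mem_graph_iff] at hx
      exact ⟨trivial, by simpa using hx⟩
    have : ((0 : V), (1 : ℝ)) ∈ Submodule.prod (⊤ : Submodule ℝ V) (⊥ : Submodule ℝ ℝ) :=
      hle (by rw [h]; trivial)
    exact one_ne_zero (α := ℝ) (by simpa using this.2)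
  · intro h
    obtain ⟨v, hv⟩ : ∃ v, ξ v ≠ 0 := by
      by_contra! h0
      exact h (LinearMap.ext h0)
    rw [eq_top_iff]
    rintro ⟨x, t⟩ -
    refine Submodule.mem_sup.2 ⟨((t / ξ v) • v, t), ?_, (x - (t / ξ v) • v, 0), ?_, ?_⟩
    · rw [LinearMap.mem_graph_iff]
      simp [hv]
    · exact ⟨trivial, rfl⟩
    · simp

/-- The differential of a chart. -/
noncomputable def chartDeriv (φ : OpenPartialHomeomorph M (EuclideanSpace ℝ (Fin n))) (x : M) :
    TangentSpace (𝓡 n) x →ₗ[ℝ] EuclideanSpace ℝ (Fin n) :=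
  (mfderiv (𝓡 n) (𝓡 n) φ x).toLinearMap

variable {φ : OpenPartialHomeomorph M (EuclideanSpace ℝ (Fin n))}

theorem chartDeriv_bijective [IsManifold (𝓡 n) ∞ M]
    (hφ : φ ∈ IsManifold.maximalAtlas (𝓡 n) ∞ M) {x : M} (hx : x ∈ φ.source) :
    Function.Bijective (chartDeriv φ x) :=
  (mdifferentiable_of_mem_maximalAtlas hφ).mfderiv_bijective hx

theorem contMDiffOn_comp_chart [IsManifold (𝓡 n) ∞ M]
    (hφ : φ ∈ IsManifold.maximalAtlas (𝓡 n) ∞ M)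
    (L : Module.Dual ℝ (EuclideanSpace ℝ (Fin n))) :
    ContMDiffOn (𝓡 n) 𝓘(ℝ, ℝ) ∞ (fun y => L (φ y)) φ.source :=
  (LinearMap.toContinuousLinearMap L).contDiff.contMDiff.comp_contMDiffOn
    (contMDiffOn_of_mem_maximalAtlas hφ)

theorem covector_comp_chart [IsManifold (𝓡 n) ∞ M]
    (hφ : φ ∈ IsManifold.maximalAtlas (𝓡 n) ∞ M) {x : M} (hx : x ∈ φ.source)
    (L : Module.Dual ℝ (EuclideanSpace ℝ (Fin n))) :
    covector (n := n) (fun y => L (φ y)) x = L ∘ₗ chartDeriv φ x := by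
  have := (hasMFDerivAt_comp_chart hφ hx (LinearMap.toContinuousLinearMap L)).mfderiv
  exact congrArg ContinuousLinearMap.toLinearMap this

/-- In a chart, the components of `P` are smooth on `O`. -/
def HasSmoothComponents {r : ℕ} (φ : OpenPartialHomeomorph M (EuclideanSpace ℝ (Fin n)))
    (P : MultivectorField n M r) (O : Set M) : Prop :=
  ∀ ℓ : Module.Dual ℝ (⋀[ℝ]^r (EuclideanSpace ℝ (Fin n))),
    ContMDiffOn (𝓡 n) 𝓘(ℝ, ℝ) ∞ (fun x => ℓ (exteriorPower.map r (chartDeriv φ x) (P x))) O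

theorem MultivectorField.SmoothOn.hasSmoothComponents [IsManifold (𝓡 n) ∞ M]
    (hφ : φ ∈ IsManifold.maximalAtlas (𝓡 n) ∞ M) {r : ℕ} {P : MultivectorField n M r} {U : Set M}
    (hU : IsOpen U) (hP : P.SmoothOn U) : HasSmoothComponents φ P (U ∩ φ.source) := by
  intro ℓ
  let b := Module.finBasis ℝ (EuclideanSpace ℝ (Fin n))
  have hev : ∀ L : Fin r → Module.Dual ℝ (EuclideanSpace ℝ (Fin n)),
      ContMDiffOn (𝓡 n) 𝓘(ℝ, ℝ) ∞ (fun x =>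
        exteriorPower.pairingDual ℝ _ r (exteriorPower.ιMulti ℝ r L)
          (exteriorPower.map r (chartDeriv φ x) (P x))) (U ∩ φ.source) := by
    intro L
    refine (hP (U ∩ φ.source) (hU.inter φ.open_source) inter_subset_left
      (fun i y => L i (φ y)) fun i => (contMDiffOn_comp_chart hφ (L i)).mono
        inter_subset_right).congr fun x hx => ?_
    rw [pairingDual_map]
    unfold MultivectorField.eval
    congr 3
    ext i : 1
    rw [covector_comp_chart hφ hx.2]
  have hsum : ∀ x, ℓ (exteriorPower.map r (chartDeriv φ x) (P x)) =
      ∑ S, exteriorPower.ιMultiDual ℝ r b S (exteriorPower.map r (chartDeriv φ x) (P x)) *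
        ℓ (b.exteriorPower r S) := by
    intro x
    conv_lhs => rw [← (b.exteriorPower r).sum_repr (exteriorPower.map r (chartDeriv φ x) (P x))]
    rw [map_sum]
    refine Finset.sum_congr rfl fun S _ => ?_
    rw [map_smul, exteriorPower.basis_repr_apply, smul_eq_mul]
  simp only [hsum]
  refine contMDiffOn_finsetSum fun S _ => ?_
  exact (hev _).mul contMDiffOn_const

/-- Functions into an algebra that are combinations of fixed elements with smooth coefficients. -/
def IsSmoothCombination {A : Type*} [Ring A] [Algebra ℝ A] (O : Set M) (a : M → A) : Prop :=
  ∃ (ι : Type) (_ : Fintype ι) (c : ι → M → ℝ) (b : ι → A),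
    (∀ i, ContMDiffOn (𝓡 n) 𝓘(ℝ, ℝ) ∞ (c i) O) ∧ ∀ x ∈ O, a x = ∑ i, c i x • b i

theorem IsSmoothCombination.mul {A : Type*} [Ring A] [Algebra ℝ A] {O : Set M} {a a' : M → A}
    (h : IsSmoothCombination (n := n) O a) (h' : IsSmoothCombination (n := n) O a') :
    IsSmoothCombination (n := n) O (fun x => a x * a' x) := by
  obtain ⟨ι, _, c, b, hc, hab⟩ := h
  obtain ⟨ι', _, c', b', hc', hab'⟩ := h'
  refine ⟨ι × ι', inferInstance, fun p x => c p.1 x * c' p.2 x, fun p => b p.1 * b' p.2,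
    fun p => (hc p.1).mul (hc' p.2), fun x hx => ?_⟩
  beta_reduce
  rw [hab x hx, hab' x hx, Finset.sum_mul_sum, Fintype.sum_prod_type]
  refine Finset.sum_congr rfl fun i _ => Finset.sum_congr rfl fun j _ => ?_
  rw [smul_mul_smul_comm]

theorem IsSmoothCombination.pow {A : Type*} [Ring A] [Algebra ℝ A] {O : Set M} {a : M → A}
    (h : IsSmoothCombination (n := n) O a) (k : ℕ) :
    IsSmoothCombination (n := n) O (fun x => a x ^ k) := by
  induction k with
  | zero => exact ⟨Unit, inferInstance, fun _ _ => 1, fun _ => 1, fun _ => contMDiffOn_const,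
      fun x _ => by simp⟩
  | succ k ih => simpa only [pow_succ] using ih.mul h

theorem IsSmoothCombination.contMDiffOn_apply {A : Type*} [Ring A] [Algebra ℝ A] {O : Set M}
    {a : M → A} (h : IsSmoothCombination (n := n) O a) (ℓ : Module.Dual ℝ A) :
    ContMDiffOn (𝓡 n) 𝓘(ℝ, ℝ) ∞ (fun x => ℓ (a x)) O := by
  obtain ⟨ι, _, c, b, hc, hab⟩ := h
  refine (contMDiffOn_finsetSum (t := Finset.univ) (f := fun i x => c i x * ℓ (b i))
    fun i _ => (hc i).mul contMDiffOn_const).congr fun x hx => ?_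
  rw [hab x hx, map_sum]
  exact Finset.sum_congr rfl fun i _ => by rw [map_smul, smul_eq_mul]

/-- The components of the power are polynomials in those of π. Products are computed in the exterior
algebra with smooth scalar coefficients on fixed vectors, so no topology on the algebra is needed;
the functional is first extended from ⋀^{2k} to the whole algebra. -/
theorem HasSmoothComponents.wedgePow {π : MultivectorField n M 2} {O : Set M}
    (h : HasSmoothComponents φ π O) (k : ℕ) :
    HasSmoothComponents φ (fun x => wedgePow (π x) k) O := by
  let b := (Module.finBasis ℝ (EuclideanSpace ℝ (Fin n))).exteriorPower 2
  have hcomb : IsSmoothCombination (n := n) O (fun x =>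
      (exteriorPower.map 2 (chartDeriv φ x) (π x) :
        ExteriorAlgebra ℝ (EuclideanSpace ℝ (Fin n)))) := by
    refine ⟨_, inferInstance, fun S x => b.coord S (exteriorPower.map 2 (chartDeriv φ x) (π x)),
      fun S => (b S : ExteriorAlgebra ℝ (EuclideanSpace ℝ (Fin n))), fun S => h _, fun x _ => ?_⟩
    have := congrArg Subtype.val (b.sum_repr (exteriorPower.map 2 (chartDeriv φ x) (π x)))
    beta_reduce
    rw [← this, AddSubmonoidClass.coe_finsetSum]
    rfl
  intro ℓ
  obtain ⟨ℓ', hℓ'⟩ := LinearMap.exists_extend ℓ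
  refine ((hcomb.pow k).contMDiffOn_apply ℓ').congr fun x _ => ?_
  rw [← wedgePow_map, ← hℓ']
  rfl

/-- A function relating two sections with smooth components is smooth where the second one does
not vanish. -/
theorem HasSmoothComponents.exists_contMDiffOn_coefficient [IsManifold (𝓡 n) ∞ M]
    (hφ : φ ∈ IsManifold.maximalAtlas (𝓡 n) ∞ M) {r : ℕ} {P σ : MultivectorField n M r}
    {O : Set M} (hO : IsOpen O) (hP : HasSmoothComponents φ P O) (hσ : HasSmoothComponents φ σ O)
    {f : M → ℝ} (hf : ∀ y ∈ O, P y = f y • σ y) {x : M} (hx : x ∈ O) (hxφ : x ∈ φ.source)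
    (hσx : σ x ≠ 0) :
    ∃ O', IsOpen O' ∧ x ∈ O' ∧ O' ⊆ O ∧ ContMDiffOn (𝓡 n) 𝓘(ℝ, ℝ) ∞ f O' := by
  have hne : exteriorPower.map r (chartDeriv φ x) (σ x) ≠ 0 := fun h0 =>
    hσx (exteriorPower.map_injective_field
      (chartDeriv_bijective hφ hxφ).1 (by rw [h0, map_zero]))
  obtain ⟨ℓ, hℓ⟩ : ∃ ℓ : Module.Dual ℝ (⋀[ℝ]^r (EuclideanSpace ℝ (Fin n))),
      ℓ (exteriorPower.map r (chartDeriv φ x) (σ x)) ≠ 0 := by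
    by_contra! h
    exact hne ((Module.forall_dual_apply_eq_zero_iff ℝ _).1 h)
  -- A component of σ that is nonzero at `x` stays nonzero nearby, and there `f` is the quotient of
  -- the matching components of `P` and σ.
  set g : M → ℝ := fun y => ℓ (exteriorPower.map r (chartDeriv φ y) (σ y)) with hg
  have hgO : ContMDiffOn (𝓡 n) 𝓘(ℝ, ℝ) ∞ g O := hσ ℓ
  refine ⟨O ∩ g ⁻¹' {0}ᶜ, hgO.continuousOn.isOpen_inter_preimage hO isOpen_compl_singleton,
    ⟨hx, hℓ⟩, inter_subset_left, ?_⟩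
  refine (((hP ℓ).mono inter_subset_left).div₀ (hgO.mono inter_subset_left)
    fun y hy => hy.2).congr fun y hy => ?_
  have hy2 : g y ≠ 0 := hy.2
  change f y = ℓ (exteriorPower.map r (chartDeriv φ y) (P y)) / g y
  rw [hf y hy.1, map_smul, map_smul, smul_eq_mul]
  exact (mul_div_cancel_right₀ (f y) hy2).symm

end Coefficients

/-! ## Multivector fields tangent to the fibres of a submersion -/

section Tangent

open Set Topology

variable {n q d : ℕ} {M : Type u} [TopologicalSpace M]
  [ChartedSpace (EuclideanSpace ℝ (Fin n)) M] {B : Type v} [TopologicalSpace B]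
  [ChartedSpace (EuclideanSpace ℝ (Fin q)) B] {pr : M → B}

/-- `P` pairs to zero with any product of covectors one of which vanishes on `D`. -/
def IsTangentTo {V : Type*} [AddCommGroup V] [Module ℝ V] {r : ℕ} (D : Submodule ℝ V)
    (P : ⋀[ℝ]^r V) : Prop :=
  ∀ ξ : Fin r → Module.Dual ℝ V, (∃ i, ∀ v ∈ D, ξ i v = 0) →
    exteriorPower.pairingDual ℝ V r (exteriorPower.ιMulti ℝ r ξ) P = 0

theorem IsTangentTo.exists_map_eq {V W : Type*} [AddCommGroup V] [Module ℝ V] [AddCommGroup W]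
    [Module ℝ W] [FiniteDimensional ℝ W] {r : ℕ} {P : ⋀[ℝ]^r W} {A : V →ₗ[ℝ] W}
    (h : IsTangentTo A.range P) (hA : Function.Injective A) :
    ∃ Q : ⋀[ℝ]^r V, exteriorPower.map r A Q = P := by
  refine mem_range_map_of_pairingDual_eq_zero hA fun ξ ⟨i, hi⟩ => h ξ ⟨i, ?_⟩
  rintro _ ⟨v, rfl⟩
  exact DFunLike.congr_fun hi v

theorem isTangentTo_map_subtype {V : Type*} [AddCommGroup V] [Module ℝ V] {r : ℕ}
    {D : Submodule ℝ V} (Q : ⋀[ℝ]^r D) : IsTangentTo D (exteriorPower.map r D.subtype Q) := by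
  rintro ξ ⟨i, hi⟩
  rw [pairingDual_map]
  have h0 : exteriorPower.ιMulti ℝ r (fun i => ξ i ∘ₗ D.subtype) = 0 :=
    (exteriorPower.ιMulti ℝ r).map_coord_zero i (LinearMap.ext fun v => hi v v.2)
  rw [h0, map_zero, LinearMap.zero_apply]

theorem IsTangentTo.wedgePow {V : Type*} [AddCommGroup V] [Module ℝ V] [FiniteDimensional ℝ V]
    {D : Submodule ℝ V} {p : ⋀[ℝ]^2 V} (h : IsTangentTo D p) (k : ℕ) :
    IsTangentTo D (wedgePow p k) := by
  obtain ⟨Q, rfl⟩ := IsTangentTo.exists_map_eq (A := D.subtype) (by rwa [Submodule.range_subtype])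
    D.injective_subtype
  rw [wedgePow_map]
  exact isTangentTo_map_subtype _

theorem IsTangentTo.smul {V : Type*} [AddCommGroup V] [Module ℝ V] {r : ℕ}
    {D : Submodule ℝ V} {P : ⋀[ℝ]^r V} (h : IsTangentTo D P) (c : ℝ) : IsTangentTo D (c • P) := by
  intro ξ hξ
  rw [map_smul, h ξ hξ, smul_zero]

/-- A smooth multivector field that is tangent to the fibres of a submersion at a dense set of
points is so everywhere. -/
theorem MultivectorField.SmoothOn.isTangentTo_ker [IsManifold (𝓡 n) ∞ M] [IsManifold (𝓡 q) ∞ B]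
    (hpr : ContMDiff (𝓡 n) (𝓡 q) ∞ pr) (s : SubmersionChart n q d pr) {r : ℕ}
    {P : MultivectorField n M r} {U : Set M} (hU : IsOpen U) (hP : P.SmoothOn U) {x : M}
    (hxU : x ∈ U) (hxs : x ∈ s.dom.source)
    (hdense : ∃ᶠ y in 𝓝 x, IsTangentTo (mfderiv (𝓡 n) (𝓡 q) pr y).toLinearMap.ker (P y)) :
    IsTangentTo (mfderiv (𝓡 n) (𝓡 q) pr x).toLinearMap.ker (P x) := by
  rintro ξ ⟨i, hi⟩
  let A := LinearEquiv.ofBijective _ (chartDeriv_bijective s.dom_mem hxs)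
  -- The covectors at `x` are extended with constant coefficients in the adapted chart. As `pr` is
  -- linear there, the `i`-th extension annihilates the kernel at every point of the chart, so the
  -- continuous value of `P` on them vanishes on points accumulating at `x`.
  let L : Fin r → Module.Dual ℝ (EuclideanSpace ℝ (Fin n)) := fun j => ξ j ∘ₗ A.symm.toLinearMap
  have hLx : ∀ j, L j ∘ₗ chartDeriv s.dom x = ξ j := fun j =>
    LinearMap.ext fun v => congrArg (ξ j) (A.symm_apply_apply v)
  have hLi : ∀ w, (s.equiv w).1 = 0 → L i w = 0 := by
    intro w hw
    refine hi _ ((s.mem_ker_mfderiv_iff hpr hxs _).2 ?_)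
    change (s.equiv (A (A.symm w))).1 = 0
    rwa [A.apply_symm_apply]
  let F : Fin r → M → ℝ := fun j y => L j (s.dom y)
  have hcont : ContinuousAt (P.eval F) x :=
    ((hP (U ∩ s.dom.source) (hU.inter s.dom.open_source) inter_subset_left F fun j =>
      (contMDiffOn_comp_chart s.dom_mem (L j)).mono inter_subset_right).continuousOn.continuousAt
        ((hU.inter s.dom.open_source).mem_nhds ⟨hxU, hxs⟩))
  have hev : ∀ y ∈ s.dom.source, P.eval F y = exteriorPower.pairingDual ℝ _ r
      (exteriorPower.ιMulti ℝ r fun j => L j ∘ₗ chartDeriv s.dom y) (P y) := by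
    intro y hy
    unfold MultivectorField.eval
    congr 3
    ext j : 1
    exact covector_comp_chart s.dom_mem hy (L j)
  have hx0 : P.eval F x = 0 := by
    by_contra hne
    obtain ⟨y, hy, hyne, hys⟩ := (hdense.and_eventually
      ((hcont.eventually_ne hne).and (s.dom.open_source.mem_nhds hxs))).exists
    refine hyne ?_
    rw [hev y hys]
    exact hy _ ⟨i, fun v hv => hLi _ ((s.mem_ker_mfderiv_iff hpr hys v).1 hv)⟩
  rw [hev x hxs] at hx0
  simpa only [hLx] using hx0

/-- Restriction to a fibre of a multivector field tangent to the fibre. -/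
theorem exists_restriction_fiber [IsManifold (𝓡 n) ∞ M] [IsManifold (𝓡 q) ∞ B]
    (hpr : ContMDiff (𝓡 n) (𝓡 q) ∞ pr)
    (h : ∀ x : M, ∃ s : SubmersionChart n q d pr, x ∈ s.dom.source) (c : B) {r : ℕ}
    {P : MultivectorField n M r} {U : Set M} (hU : IsOpen U) (hP : P.SmoothOn U)
    (htan : ∀ x ∈ U, IsTangentTo (mfderiv (𝓡 n) (𝓡 q) pr x).toLinearMap.ker (P x)) :
    letI := fiberChartedSpace h c
    ∃ Q : MultivectorField d (pr ⁻¹' {c}) r, Q.SmoothOn (Subtype.val ⁻¹' U) ∧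
      ∀ p : pr ⁻¹' {c}, (p : M) ∈ U → exteriorPower.map r
        (mfderiv (𝓡 d) (𝓡 n) (Subtype.val : pr ⁻¹' {c} → M) p).toLinearMap (Q p) = P p := by
  let := fiberChartedSpace h c
  have := isManifold_fiber h c
  have hemb := isSmoothEmbedding_fiber h c
  have hrange := hasTangent_fiber h c hpr
  have hex : ∀ p : pr ⁻¹' {c}, ∃ Q : ⋀[ℝ]^r (TangentSpace (𝓡 d) p),
      (p : M) ∈ U → exteriorPower.map r
        (mfderiv (𝓡 d) (𝓡 n) (Subtype.val : pr ⁻¹' {c} → M) p).toLinearMap Q = P p := by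
    intro p
    by_cases hp : (p : M) ∈ U
    · obtain ⟨Q, hQ⟩ := IsTangentTo.exists_map_eq
        (A := (mfderiv (𝓡 d) (𝓡 n) (Subtype.val : pr ⁻¹' {c} → M) p).toLinearMap) (P := P p)
        (by rw [hrange p]; exact htan p hp)
        (mfderiv_injective_of_isImmersionAt (hemb.isImmersion.isImmersionAt p))
      exact ⟨Q, fun _ => hQ⟩
    · exact ⟨0, fun h => absurd h hp⟩
  choose Q hQ using hex
  refine ⟨Q, fun V hV hVU f hf p hp => ?_, hQ⟩
  obtain ⟨O, F, hO, hpO, hOV, hF, hFf⟩ := exists_local_extension_fiber h c hV p hp f hf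
  have hsm : ContMDiffAt (𝓡 n) 𝓘(ℝ, ℝ) ∞ (P.eval F) p :=
    (hP (O ∩ U) (hO.inter hU) inter_subset_right F fun i =>
      (hF i).mono inter_subset_left).contMDiffAt ((hO.inter hU).mem_nhds ⟨hpO, hVU hp⟩)
  have hOn : Subtype.val ⁻¹' O ∈ 𝓝 p := (hO.preimage continuous_subtype_val).mem_nhds hpO
  refine ((hsm.comp p hemb.contMDiff.contMDiffAt).congr_of_eventuallyEq ?_).contMDiffWithinAt
  filter_upwards [hOn] with z hz
  refine MultivectorField.eval_eq_of_map_eq (hemb.contMDiff.mdifferentiable (by simp) z)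
    (hQ z (hVU (hOV hz))) (fun i => ((hF i).contMDiffAt (hO.mem_nhds hz)).mdifferentiableAt
      (by simp)) fun i => ?_
  filter_upwards [(hO.preimage continuous_subtype_val).mem_nhds hz] with y hy
  exact (hFf i y hy).symm

end Tangent

/-! ## Log-f symplectic structures and their leaves -/

section LogF

open Set Topology

variable {n q : ℕ} {M : Type u} [TopologicalSpace M]
  [ChartedSpace (EuclideanSpace ℝ (Fin n)) M] {B : Type v} [TopologicalSpace B]
  [ChartedSpace (EuclideanSpace ℝ (Fin q)) B] {pr : M → B}

/-- `mfderiv` is zero by convention where a function is not differentiable. Transversality therefore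
yields the differentiability of the coefficient `f` that its definition does not ask for. -/
theorem mdifferentiableAt_of_covector_ne_zero {f : M → ℝ} {x : M}
    (h : covector (n := n) f x ≠ 0) : MDifferentiableAt (𝓡 n) 𝓘(ℝ, ℝ) f x := by
  by_contra hf
  refine h ?_
  unfold covector
  rw [mfderiv_zero_of_not_mdifferentiableAt hf]
  rfl

theorem covector_const (a : ℝ) (x : M) : covector (n := n) (fun _ => a) x = 0 := by
  unfold covector
  rw [mfderiv_const]
  rfl

theorem covector_mul_of_eq_zero {f u : M → ℝ} {x : M}
    (hf : MDifferentiableAt (𝓡 n) 𝓘(ℝ, ℝ) f x) (hu : MDifferentiableAt (𝓡 n) 𝓘(ℝ, ℝ) u x)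
    (h0 : f x = 0) :
    covector (n := n) (fun y => u y * f y) x = u x • covector (n := n) f x := by
  have h1 := (hu.hasMFDerivAt.mul hf.hasMFDerivAt).mfderiv
  ext v
  have h2 := DFunLike.congr_fun h1 v
  have h3 : covector (n := n) (fun y => u y * f y) x v =
      u x * covector (n := n) f x v + f x * covector (n := n) u x v := h2
  rw [h3, h0, zero_mul, add_zero]
  rfl

namespace IsLogFSymplectic

variable {π : MultivectorField n M 2} {k : ℕ}
  {K : ∀ x : M, Submodule ℝ (⋀[ℝ]^(2 * k) (TangentSpace (𝓡 n) x))}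

/-- If the power vanished near `x`, so would its coefficient in a frame, contradicting df ≠ 0. -/
theorem frequently_wedgePow_ne_zero (hπ : IsLogFSymplectic π k K) (x : M) :
    ∃ᶠ y in 𝓝 x, wedgePow (π y) k ≠ 0 := by
  intro hev
  simp only [not_not] at hev
  obtain ⟨U, σ, f, hxU, hσ, hf, htr⟩ := hπ.transverse x hev.self_of_nhds
  rw [graph_sup_eq_top_iff] at htr
  refine htr ?_
  rw [← covector_const (n := n) (0 : ℝ) x]
  refine covector_congr ?_
  filter_upwards [hev, hσ.isOpen.mem_nhds hxU] with y hy hyU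
  have : wedgePow (π y) k = f y • σ y := hf y hyU
  rw [hy] at this
  exact (smul_eq_zero.1 this.symm).resolve_right (hσ.ne_zero y hyU)

theorem isTangentTo_assocDistribution (hπ : IsLogFSymplectic π k K) {x : M}
    (hx : wedgePow (π x) k ≠ 0) : IsTangentTo (assocDistribution K x) (π x) := by
  rintro ξ ⟨i, hi⟩
  refine pairingDual_eq_zero_of_wedgePow_succ_eq_zero (hπ.pow_succ_eq_zero x) (i := i)
    fun v hv => hi v fun κ hκ => ?_
  obtain ⟨U, σ, hxU, hσ⟩ := hπ.lineSubbundle x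
  have hmem := hπ.mem x
  rw [hσ.span_eq x hxU, Submodule.mem_span_singleton] at hmem hκ
  obtain ⟨a, ha⟩ := hmem
  obtain ⟨b, rfl⟩ := hκ
  have ha0 : a ≠ 0 := by
    rintro rfl
    exact hx (by rw [← ha, zero_smul])
  have hσx : σ x = a⁻¹ • wedgePow (π x) k := by
    rw [← ha, smul_smul, inv_mul_cancel₀ ha0, one_smul]
  rw [hσx, Submodule.coe_smul, Submodule.coe_smul, mul_smul_comm, mul_smul_comm, hv, smul_zero,
    smul_zero]

variable [IsManifold (𝓡 n) ∞ M] [IsManifold (𝓡 q) ∞ B]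

theorem isTangentTo_ker (hπ : IsLogFSymplectic π k K)
    (hpr : IsLeafSpace (q := q) (2 * k) (assocDistribution K) pr) (x : M) :
    IsTangentTo (mfderiv (𝓡 n) (𝓡 q) pr x).toLinearMap.ker (π x) := by
  obtain ⟨s, hs⟩ := (hpr.exists_chart_and_eq_ker x).1
  refine hπ.poisson.smooth.isTangentTo_ker hpr.submersion.contMDiff s isOpen_univ (mem_univ x) hs ?_
  refine (hπ.frequently_wedgePow_ne_zero x).mono fun y hy => ?_
  rw [← (hpr.exists_chart_and_eq_ker y).2]
  exact hπ.isTangentTo_assocDistribution hy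

/-- Where `f` is nonzero the frame is a multiple of ⋀^k π, which is tangent; such points are dense,
and tangency passes to the limit. -/
theorem frame_isTangentTo_ker (hπ : IsLogFSymplectic π k K)
    (hpr : IsLeafSpace (q := q) (2 * k) (assocDistribution K) pr) {U : Set M}
    {σ : MultivectorField n M (2 * k)} (hσ : IsLocalFrame K U σ) {f : M → ℝ}
    (hf : ∀ y ∈ U, wedgePow (π y) k = f y • σ y) {x : M} (hx : x ∈ U) :
    IsTangentTo (mfderiv (𝓡 n) (𝓡 q) pr x).toLinearMap.ker (σ x) := by
  obtain ⟨s, hs⟩ := (hpr.exists_chart_and_eq_ker x).1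
  refine hσ.smooth.isTangentTo_ker hpr.submersion.contMDiff s hσ.isOpen hx hs ?_
  refine ((hπ.frequently_wedgePow_ne_zero x).and_eventually (hσ.isOpen.mem_nhds hx)).mono ?_
  rintro y ⟨hy, hyU⟩
  have hfy : f y ≠ 0 := by
    intro h0
    exact hy (by rw [hf y hyU, h0, zero_smul])
  have : σ y = (f y)⁻¹ • wedgePow (π y) k := by
    rw [hf y hyU, smul_smul, inv_mul_cancel₀ hfy, one_smul]
  rw [this]
  exact ((hπ.isTangentTo_ker hpr y).wedgePow k).smul _

end IsLogFSymplectic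

/-- The restriction of a Poisson structure to a fibre it is tangent to is Poisson. -/
theorem IsPoisson.restrict_fiber [IsManifold (𝓡 n) ∞ M] {d : ℕ} {π : MultivectorField n M 2}
    (hπ : IsPoisson π) (h : ∀ x : M, ∃ s : SubmersionChart n q d pr, x ∈ s.dom.source) (c : B)
    {Q : letI := fiberChartedSpace h c
      MultivectorField d (pr ⁻¹' {c}) 2}
    (hQs : letI := fiberChartedSpace h c
      MultivectorField.SmoothOn Q univ)
    (hQ : letI := fiberChartedSpace h c
      ∀ p : pr ⁻¹' {c}, exteriorPower.map 2
        (mfderiv (𝓡 d) (𝓡 n) (Subtype.val : pr ⁻¹' {c} → M) p).toLinearMap (Q p) = π p) :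
    letI := fiberChartedSpace h c
    IsPoisson Q := by
  let := fiberChartedSpace h c
  have := isManifold_fiber h c
  have hemb := isSmoothEmbedding_fiber h c
  refine ⟨hQs, fun V hV f₁ f₂ f₃ hf₁ hf₂ hf₃ p hp => ?_⟩
  obtain ⟨O, F, hO, hpO, hOV, hF, hFf⟩ := exists_local_extension_fiber h c hV p hp ![f₁, f₂, f₃]
    (by
      intro i
      fin_cases i
      · exact hf₁
      · exact hf₂
      · exact hf₃)
  -- The bracket of extensions is a smooth extension of the bracket, so the rule can be iterated and
  -- the Jacobi identity descends from `M`.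
  have hbr : ∀ (a b : pr ⁻¹' {c} → ℝ) (A C : M → ℝ),
      ContMDiffOn (𝓡 n) 𝓘(ℝ, ℝ) ∞ A O → ContMDiffOn (𝓡 n) 𝓘(ℝ, ℝ) ∞ C O →
      (∀ z : pr ⁻¹' {c}, (z : M) ∈ O → A z = a z) →
      (∀ z : pr ⁻¹' {c}, (z : M) ∈ O → C z = b z) →
      ContMDiffOn (𝓡 n) 𝓘(ℝ, ℝ) ∞ (poissonBracket π A C) O ∧
      ∀ z : pr ⁻¹' {c}, (z : M) ∈ O → poissonBracket π A C z = poissonBracket Q a b z := by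
    intro a b A C hA hC hAa hCb
    have hAC : ∀ i, ContMDiffOn (𝓡 n) 𝓘(ℝ, ℝ) ∞ (![A, C] i) O := by
      intro i
      fin_cases i
      · exact hA
      · exact hC
    refine ⟨hπ.smooth O hO (subset_univ _) _ hAC, fun z hz => ?_⟩
    refine (MultivectorField.eval_eq_of_map_eq (hemb.contMDiff.mdifferentiable (by simp) z) (hQ z)
      (fun i => ((hAC i).contMDiffAt (hO.mem_nhds hz)).mdifferentiableAt (by simp))
      fun i => ?_).symm
    filter_upwards [(hO.preimage continuous_subtype_val).mem_nhds hz] with y hy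
    fin_cases i
    · exact (hAa y hy).symm
    · exact (hCb y hy).symm
  have h12 := hbr f₁ f₂ (F 0) (F 1) (hF 0) (hF 1) (hFf 0) (hFf 1)
  have h23 := hbr f₂ f₃ (F 1) (F 2) (hF 1) (hF 2) (hFf 1) (hFf 2)
  have h31 := hbr f₃ f₁ (F 2) (F 0) (hF 2) (hF 0) (hFf 2) (hFf 0)
  have h1 := hbr f₁ _ (F 0) _ (hF 0) h23.1 (hFf 0) h23.2
  have h2 := hbr f₂ _ (F 1) _ (hF 1) h31.1 (hFf 1) h31.2
  have h3 := hbr f₃ _ (F 2) _ (hF 2) h12.1 (hFf 2) h12.2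
  rw [← h1.2 p hpO, ← h2.2 p hpO, ← h3.2 p hpO]
  exact hπ.jacobi O hO _ _ _ (hF 0) (hF 1) (hF 2) p hpO

/-- The differential of a function in the product coordinates of an adapted chart. -/
theorem SubmersionChart.covector_apply [IsManifold (𝓡 n) ∞ M] {d : ℕ} (s : SubmersionChart n q d pr) {f : M → ℝ} {x : M}
    (hx : x ∈ s.dom.source) {g : EuclideanSpace ℝ (Fin q) × EuclideanSpace ℝ (Fin d) → ℝ}
    (hg : DifferentiableAt ℝ g (s.equiv (s.dom x)))
    (hfg : f =ᶠ[𝓝 x] fun y => g (s.equiv (s.dom y))) (v : TangentSpace (𝓡 n) x) :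
    covector (n := n) f x v = fderiv ℝ g (s.equiv (s.dom x)) (s.equiv (chartDeriv s.dom x v)) := by
  rw [covector_congr hfg]
  have h1 := hasMFDerivAt_comp_chart s.dom_mem hx s.equiv.toContinuousLinearMap
  have h2 := (hg.hasFDerivAt.hasMFDerivAt.comp x h1).mfderiv
  exact DFunLike.congr_fun h2 v

variable [IsManifold (𝓡 n) ∞ M] [IsManifold (𝓡 q) ∞ B] {π : MultivectorField n M 2} {k : ℕ}
  {K : ∀ x : M, Submodule ℝ (⋀[ℝ]^(2 * k) (TangentSpace (𝓡 n) x))}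

/-- The zeros of `⋀^k π` at which its zero locus is tangent to the distribution `D`. -/
def tangencyLocus (π : MultivectorField n M 2) (k : ℕ)
    (K : ∀ x : M, Submodule ℝ (⋀[ℝ]^(2 * k) (TangentSpace (𝓡 n) x))) : Set M :=
  {x | wedgePow (π x) k = 0 ∧ ∃ (U : Set M) (σ : MultivectorField n M (2 * k)) (f : M → ℝ),
    x ∈ U ∧ IsLocalFrame K U σ ∧ (∀ y ∈ U, wedgePow (π y) k = f y • σ y) ∧
      covector (n := n) f x ≠ 0 ∧ ∀ v ∈ assocDistribution K x, covector (n := n) f x v = 0}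

theorem IsLogFSymplectic.isLogSymplecticLeaf (hπ : IsLogFSymplectic π k K)
    (hpr : IsLeafSpace (q := q) (2 * k) (assocDistribution K) pr) {c : B}
    (hc : c ∉ pr '' tangencyLocus π k K) :
    IsLogSymplecticLeaf π k (assocDistribution K) (pr ⁻¹' {c}) := by
  have h := fun x => (hpr.exists_chart_and_eq_ker x).1
  have hsm := hpr.submersion.contMDiff
  let := fiberChartedSpace h c
  have := isManifold_fiber h c
  have hemb := isSmoothEmbedding_fiber h c
  have hker : assocDistribution K = fun x => (mfderiv (𝓡 n) (𝓡 q) pr x).toLinearMap.ker :=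
    funext fun x => (hpr.exists_chart_and_eq_ker x).2
  have htan : HasTangent (d := 2 * k) (assocDistribution K) (Subtype.val : pr ⁻¹' {c} → M) := by
    rw [hker]
    exact hasTangent_fiber h c hsm
  have hinj : ∀ (r : ℕ) (p : pr ⁻¹' {c}), Function.Injective (exteriorPower.map r
      (mfderiv (𝓡 (2 * k)) (𝓡 n) (Subtype.val : pr ⁻¹' {c} → M) p).toLinearMap) := fun r p =>
    exteriorPower.map_injective_field
      (mfderiv_injective_of_isImmersionAt (hemb.isImmersion.isImmersionAt p))
  obtain ⟨Q, hQs, hQ⟩ := exists_restriction_fiber hsm h c isOpen_univ hπ.poisson.smooth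
    fun x _ => hπ.isTangentTo_ker hpr x
  replace hQ := fun p => hQ p (mem_univ _)
  refine ⟨fiberChartedSpace h c, isManifold_fiber h c, Q, hemb, htan, hQ,
    hπ.poisson.restrict_fiber h c hQs hQ, fun p hp => ?_⟩
  have hpow : ∀ z : pr ⁻¹' {c}, exteriorPower.map (2 * k)
      (mfderiv (𝓡 (2 * k)) (𝓡 n) (Subtype.val : pr ⁻¹' {c} → M) z).toLinearMap
      (wedgePow (Q z) k) = wedgePow (π z) k := fun z => by rw [← wedgePow_map, hQ z]
  have hp0 : wedgePow (π p) k = 0 := by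
    rw [← hpow p]
    exact (congrArg _ hp).trans (map_zero _)
  obtain ⟨U, σ, f, hpU, hσ, hf, htr⟩ := hπ.transverse p hp0
  rw [graph_sup_eq_top_iff] at htr
  obtain ⟨τ, hτs, hτ⟩ := exists_restriction_fiber hsm h c hσ.isOpen hσ.smooth
    fun x hx => hπ.frame_isTangentTo_ker hpr hσ hf hx
  have hτ0 : ∀ z : pr ⁻¹' {c}, (z : M) ∈ U → τ z ≠ 0 := fun z hz h0 =>
    hσ.ne_zero z hz (by rw [← hτ z hz, h0, map_zero])
  refine ⟨Subtype.val ⁻¹' U, τ, fun z => f z, hpU,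
    ⟨hσ.isOpen.preimage continuous_subtype_val, hτs, hτ0, fun z hz => ?_⟩, fun z hz => ?_, ?_⟩
  · refine ((finrank_eq_one_iff_of_nonzero (τ z) (hτ0 z hz)).1 ?_).symm
    rw [exteriorPower.finrank_eq, finrank_tangentSpace, Nat.choose_self]
  · refine hinj _ z ?_
    rw [hpow z, map_smul, hτ z hz]
    exact hf z hz
  · rw [graph_sup_eq_top_iff, covector_comp (mdifferentiableAt_of_covector_ne_zero htr)
      (hemb.contMDiff.mdifferentiable (by simp) p)]
    intro h0
    -- If d(f|_P) vanished at `p`, then df would vanish on the tangent space of the leaf, which is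
    -- `D`, and `c` would be the image of a tangency point.
    refine hc ⟨p, ⟨hp0, U, σ, f, hpU, hσ, hf, htr, ?_⟩, p.2⟩
    rw [← htan p]
    rintro _ ⟨v, rfl⟩
    exact DFunLike.congr_fun h0 v

/-- Comparison of the coefficients of `⋀^k π` in two frames at a zero. -/
theorem exists_covector_eq_smul {U U' : Set M} {σ σ' : MultivectorField n M (2 * k)}
    {f f' : M → ℝ} {x : M} (hx : x ∈ U) (hx' : x ∈ U') (hσ : IsLocalFrame K U σ)
    (hσ' : IsLocalFrame K U' σ') (hf : ∀ y ∈ U, wedgePow (π y) k = f y • σ y)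
    (hf' : ∀ y ∈ U', wedgePow (π y) k = f' y • σ' y) (hx0 : wedgePow (π x) k = 0)
    (hd : covector (n := n) f' x ≠ 0) :
    ∃ a : ℝ, a ≠ 0 ∧ covector (n := n) f x = a • covector (n := n) f' x := by
  set φ := chartAt (EuclideanSpace ℝ (Fin n)) x
  have hφ : φ ∈ IsManifold.maximalAtlas (𝓡 n) ∞ M := IsManifold.chart_mem_maximalAtlas x
  have hxφ : x ∈ φ.source := mem_chart_source _ x
  -- The transition function between the frames. It satisfies f = a f' on the overlap, and the
  -- Leibniz rule at a zero of f' leaves df = a df'.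
  have hex : ∀ y, ∃ a : ℝ, y ∈ U ∩ U' → σ' y = a • σ y := by
    intro y
    by_cases hy : y ∈ U ∩ U'
    · have : σ' y ∈ K y := by
        rw [hσ'.span_eq y hy.2]; exact Submodule.mem_span_singleton_self _
      rw [hσ.span_eq y hy.1, Submodule.mem_span_singleton] at this
      obtain ⟨a, ha⟩ := this
      exact ⟨a, fun _ => ha.symm⟩
    · exact ⟨0, fun h => absurd h hy⟩
  choose a ha using hex
  have hO : IsOpen (U ∩ U' ∩ φ.source) := (hσ.isOpen.inter hσ'.isOpen).inter φ.open_source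
  have hc : HasSmoothComponents φ σ (U ∩ U' ∩ φ.source) := fun ℓ =>
    (hσ.smooth.hasSmoothComponents hφ hσ.isOpen ℓ).mono fun y hy => ⟨hy.1.1, hy.2⟩
  have hc' : HasSmoothComponents φ σ' (U ∩ U' ∩ φ.source) := fun ℓ =>
    (hσ'.smooth.hasSmoothComponents hφ hσ'.isOpen ℓ).mono fun y hy => ⟨hy.1.2, hy.2⟩
  obtain ⟨O', hO', hxO', -, haO'⟩ := hc'.exists_contMDiffOn_coefficient hφ hO hc
    (fun y hy => ha y hy.1) ⟨⟨hx, hx'⟩, hxφ⟩ hxφ (hσ.ne_zero x hx)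
  refine ⟨a x, ?_, ?_⟩
  · intro h0
    exact hσ'.ne_zero x hx' (by rw [ha x ⟨hx, hx'⟩, h0, zero_smul])
  · have hf'x : f' x = 0 := by
      rw [hf' x hx'] at hx0
      exact (smul_eq_zero.1 hx0).resolve_right (hσ'.ne_zero x hx')
    rw [← covector_mul_of_eq_zero (mdifferentiableAt_of_covector_ne_zero hd)
      ((haO'.contMDiffAt (hO'.mem_nhds hxO')).mdifferentiableAt (by simp)) hf'x]
    refine covector_congr ?_
    filter_upwards [hσ.isOpen.mem_nhds hx, hσ'.isOpen.mem_nhds hx'] with y hy hy'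
    have h1 := hf y hy
    rw [hf' y hy', ha y ⟨hy, hy'⟩, smul_smul] at h1
    rw [mul_comm]
    exact (smul_left_injective ℝ (hσ.ne_zero y hy) h1).symm

theorem IsLogFSymplectic.hasMeasureZero_image_tangencyLocus [SecondCountableTopology M]
    (hπ : IsLogFSymplectic π k K)
    (hpr : IsLeafSpace (q := q) (2 * k) (assocDistribution K) pr) :
    HasMeasureZero (q := q) (pr '' tangencyLocus π k K) := by
  intro e he
  have hsub : e '' (e.source ∩ pr '' tangencyLocus π k K) ⊆
      (fun x => e (pr x)) '' (tangencyLocus π k K ∩ pr ⁻¹' e.source) := by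
    rintro _ ⟨_, ⟨hb, x, hx, rfl⟩, rfl⟩
    exact ⟨x, ⟨hx, hb⟩, rfl⟩
  refine MeasureTheory.measure_mono_null hsub (measure_image_eq_zero_of_locally _ _ _ ?_)
  rintro x ⟨⟨hx0, U, σ, f, hxU, hσ, hf, -, -⟩, -⟩
  -- One frame and one adapted chart are fixed near `x`; in these coordinates the coefficient of ⋀^k
  -- π becomes the function `g` on an open set of a product, with `D` as the vertical directions.
  obtain ⟨s, hxs⟩ := (hpr.exists_chart_and_eq_ker x).1
  have hO : IsOpen (U ∩ s.dom.source) := hσ.isOpen.inter s.dom.open_source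
  have hcP : HasSmoothComponents s.dom (fun y => wedgePow (π y) k) (U ∩ s.dom.source) := by
    refine HasSmoothComponents.wedgePow (fun ℓ => ?_) k
    exact (hπ.poisson.smooth.hasSmoothComponents s.dom_mem isOpen_univ ℓ).mono
      fun y hy => ⟨mem_univ y, hy.2⟩
  obtain ⟨O, hO, hxO, hOU, hfO⟩ := hcP.exists_contMDiffOn_coefficient s.dom_mem hO
    (hσ.smooth.hasSmoothComponents s.dom_mem hσ.isOpen) (fun y hy => hf y hy.1) ⟨hxU, hxs⟩ hxs
    (hσ.ne_zero x hxU)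
  set W := s.equiv.symm ⁻¹' (s.dom.target ∩ s.dom.symm ⁻¹' O)
  have hW : IsOpen W := (s.dom.isOpen_inter_preimage_symm hO).preimage s.equiv.symm.continuous
  set g : EuclideanSpace ℝ (Fin q) × EuclideanSpace ℝ (Fin (2 * k)) → ℝ :=
    fun z => f (s.dom.symm (s.equiv.symm z))
  have hg : ContDiffOn ℝ ∞ g W := by
    have h1 : ContDiffOn ℝ ∞ (fun z => f (s.dom.symm z)) (s.dom.target ∩ s.dom.symm ⁻¹' O) := by
      rw [← contMDiffOn_iff_contDiffOn]
      exact hfO.comp ((contMDiffOn_symm_of_mem_maximalAtlas s.dom_mem).mono inter_subset_left)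
        fun z hz => hz.2
    exact h1.comp s.equiv.symm.contDiff.contDiffOn fun z hz => hz
  have hnull := measure_image_fst_vertical_critical MeasureTheory.volume hW hg
  set C := Prod.fst '' {z ∈ W | g z = 0 ∧ (∀ v, fderiv ℝ g z (0, v) = 0) ∧ fderiv ℝ g z ≠ 0}
  -- The null set is found in the chart `s.cod` of the base; the differentiable transition to the
  -- arbitrary chart `e` maps null sets to null sets.
  have hdiff : DifferentiableOn ℝ (fun b => e (s.cod.symm b))
      (s.cod.target ∩ s.cod.symm ⁻¹' e.source) := by
    have : ContDiffOn ℝ ∞ (fun b => e (s.cod.symm b)) (s.cod.target ∩ s.cod.symm ⁻¹' e.source) := by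
      rw [← contMDiffOn_iff_contDiffOn]
      exact (contMDiffOn_of_mem_maximalAtlas he).comp
        ((contMDiffOn_symm_of_mem_maximalAtlas s.cod_mem).mono inter_subset_left) fun z hz => hz.2
    exact this.differentiableOn (by simp)
  refine ⟨O, hO.mem_nhds hxO, MeasureTheory.measure_mono_null ?_
    (MeasureTheory.addHaar_image_eq_zero_of_differentiableOn_of_addHaar_eq_zero _
      (hdiff.mono inter_subset_right)
      (MeasureTheory.measure_mono_null (inter_subset_left (s := C)) hnull))⟩
  rintro _ ⟨y, ⟨⟨⟨hy0, U', σ', f', hyU', hσ', hf', hd', hv'⟩, hye⟩, hyO⟩, rfl⟩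
  have hyU := (hOU hyO).1
  have hys := (hOU hyO).2
  -- Each tangency point comes with its own frame; comparison with the fixed one changes the
  -- differential only by a nonzero factor.
  obtain ⟨a, ha, hcov⟩ := exists_covector_eq_smul hyU hyU' hσ hσ' hf hf' hy0 hd'
  have hzW : s.equiv (s.dom y) ∈ W := by
    change s.equiv.symm (s.equiv (s.dom y)) ∈ s.dom.target ∩ s.dom.symm ⁻¹' O
    rw [ContinuousLinearEquiv.symm_apply_apply]
    refine ⟨s.dom.map_source hys, ?_⟩
    rwa [mem_preimage, s.dom.left_inv hys]
  have hgf : ∀ y' ∈ s.dom.source, f y' = g (s.equiv (s.dom y')) := fun y' hy' => by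
    simp only [g, ContinuousLinearEquiv.symm_apply_apply, s.dom.left_inv hy']
  have happ := s.covector_apply hys ((hg.contDiffAt (hW.mem_nhds hzW)).differentiableAt (by simp))
    (Filter.eventuallyEq_of_mem (s.dom.open_source.mem_nhds hys) hgf)
  have hfy : f y = 0 := by
    rw [hf y hyU] at hy0
    exact (smul_eq_zero.1 hy0).resolve_right (hσ.ne_zero y hyU)
  have hcod : s.cod.symm (s.equiv (s.dom y)).1 = pr y := by
    rw [← s.apply_eq y hys, s.cod.left_inv (s.mapsTo y hys)]
  refine ⟨(s.equiv (s.dom y)).1, ⟨⟨_, ⟨hzW, ?_, fun v => ?_, fun h0 => ?_⟩, rfl⟩, ?_, ?_⟩, ?_⟩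
  · rw [← hgf y hys, hfy]
  · obtain ⟨w, hw⟩ := (chartDeriv_bijective s.dom_mem hys).2 (s.equiv.symm (0, v))
    have h1 := happ w
    rw [hw, ContinuousLinearEquiv.apply_symm_apply] at h1
    rw [← h1, hcov, LinearMap.smul_apply, hv' w, smul_zero]
    rw [(hpr.exists_chart_and_eq_ker y).2]
    refine (s.mem_ker_mfderiv_iff hpr.submersion.contMDiff hys w).2 ?_
    change (s.equiv (chartDeriv s.dom y w)).1 = 0
    rw [hw, ContinuousLinearEquiv.apply_symm_apply]
  · refine smul_ne_zero ha hd' ?_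
    rw [← hcov]
    ext v
    rw [happ v, h0]
    rfl
  · rw [← s.apply_eq y hys]
    exact s.cod.map_source (s.mapsTo y hys)
  · rw [mem_preimage, hcod]
    exact hye
  · change e (s.cod.symm _) = e (pr y)
    rw [hcod]

end LogF

theorem proposition3p6 {n q : ℕ} {M : Type u} [TopologicalSpace M] [T2Space M]
    [SecondCountableTopology M] [ChartedSpace (EuclideanSpace ℝ (Fin n)) M]
    [IsManifold (𝓡 n) ∞ M]
    (π : MultivectorField n M 2) (k : ℕ)
    (K : ∀ x : M, Submodule ℝ (⋀[ℝ]^(2 * k) (TangentSpace (𝓡 n) x)))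
    (hπ : IsLogFSymplectic π k K)
    {B : Type v} [TopologicalSpace B] [T2Space B] [SecondCountableTopology B]
    [ChartedSpace (EuclideanSpace ℝ (Fin q)) B] [IsManifold (𝓡 q) ∞ B]
    (pr : M → B) (hpr : IsLeafSpace (q := q) (2 * k) (assocDistribution K) pr) :
    ∃ X : Set B, HasMeasureZero (q := q) X ∧
      ∀ c : B, c ∉ X → IsLogSymplecticLeaf π k (assocDistribution K) (pr ⁻¹' {c}) :=
  ⟨pr '' tangencyLocus π k K, hπ.hasMeasureZero_image_tangencyLocus hpr,
    fun _ hc => hπ.isLogSymplecticLeaf hpr hc⟩
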